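/- **Setting.** There are $n$ processes, $t\le\lfloor (n-1)/3\rfloor$, and a set $B$ of at most $t$ faulty (Byzantine) processes, fixed before any random choice. A message $m$ has a sender, a sequence number and a payload; two messages conflict if they differ but have the same slot $(s,q)=(\text{sender},\text{sequence number})$. A public function assigns to every slot a set $W_{3T}(s,q)$ of $3t+1$ processes. A random oracle assigns to every slot a uniformly random set $W_{active}(s,q)$ of $\kappa\le n$ processes, and a process $p$ that probes for $(s,q)$ uses a uniformly random set $Target_p(s,q)$ of $\delta\le 3t+1$ members of $W_{3T}(s,q)$; all these choices are independent. Signatures cannot be forged, and no two different messages with the same value of the hash function $H$ ever occur. **The $Active_t$ protocol.** A sender, which numbers its messages consecutively, sends a signed statement $(s,q,H(m))$ to $W_{active}(s,q)$ as an AV-regular message and, after a timeout, to $W_{3T}(s,q)$ as a 3T-regular message. A correct process that receives (in a message of any kind) two conflicting statements signed by $s$ alerts all processes; a process that knows $s$ to be faulty ignores statements of $s$. A correct process $p$ that receives an AV-regular message, and no conflicting one before, sends informs with the statement to $Target_p(s,q)$; a correct recipient of an inform that has received no conflicting statement replies with a verification; when all $\delta$ verifications are there, $p$ signs an AV-acknowledgment.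 A correct process that receives a 3T-regular message, and no conflicting one before, signs a 3T-acknowledgment after a delay. A correct process delivers $m$, once all earlier messages of the same sender are delivered, if it receives $m$ with valid AV-acknowledgments from all of $W_{active}(s,q)$, or with 3T-acknowledgments from a recovery set, i.e. from $2t+1$ members of $W_{3T}(s,q)$. **Adversary.** The adversary controls the faulty processes, the messages to be multicast by correct processes, all speeds and all delays, and may query the oracle; it acts adaptively on what it observes. It observes all acknowledgments, alerts and deliveries and all messages to faulty processes, but it observes nothing of the probing exchanges (informs and verifications) between correct processes. This includes their timing: the moment at which a correct prober signs its AV-acknowledgment comes after the delays of the exchanges with all correct members of $W_{3T}(s,q)$ that it might have selected, and so does not reveal which of them it did select. Alerts arrive in time: after a correct process has sent an alert that exposes $s$, no correct process signs a 3T-acknowledgment for $s$. **Theorem (Probabilistic Agreement).** For every such adversary and every slot $(s,q)$, let $E$ be the event that two correct processes deliver messages $m\ne m'$ with sender $s$ and sequence number $q$, and let $F$ be the event $W_{active}(s,q)\subseteq B$. Then: 1. $\Pr[F]\le (t/n)^\kappa\le(1/3)^\kappa$. 2. Any two recovery sets for $(s,q)$ have a common correct member. 3. For every process $h$ and every recovery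 set $S$ for $(s,q)$, the probability that $Target_h(s,q)$ contains no correct member of $S$ is at most $\left(\frac{2t}{3t+1}\right)^\delta$. 4. Given that the active witness set is not entirely faulty, conflicting delivery has probability $$\Pr[E\mid F^c]\le\left(\tfrac{2t}{3t+1}\right)^\delta\le\left(\tfrac23\right)^\delta .$$ 5. Overall, $$\Pr[E]\le\left(\tfrac13\right)^\kappa+\left(1-\left(\tfrac13\right)^\kappa\right)\left(\tfrac23\right)^\delta .$$ -/

import Mathlib

open MeasureTheory ProbabilityTheory

namespace ActiveT

/-- A slot is a pair (sender, sequence number). -/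
abbrev Slot (n : ℕ) := Fin n × ℕ

/-- A multicast message. -/
structure Message (n : ℕ) (Payload : Type*) where
  sender : Fin n
  seq : ℕ
  payload : Payload

/-- The pair (sender, sequence number) of a message. -/
def Message.slot {n : ℕ} {Payload : Type*} (m : Message n Payload) : Slot n := (m.sender, m.seq)

/-- The parameters that are fixed before the execution starts, hence before any random choice:
`n` processes, the resilience threshold `t ≤ ⌊(n - 1) / 3⌋`, the size `κ` of the active witness
sets, the number `δ` of probes, the public function `W3T` that designates `3t + 1` potential
recovery witnesses for each slot, and the set of faulty processes (a non-adaptive choice). -/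
structure Config where
  n : ℕ
  t : ℕ
  κ : ℕ
  δ : ℕ
  three_t_lt : 3 * t + 1 ≤ n
  κ_le : κ ≤ n
  δ_le : δ ≤ 3 * t + 1
  W3T : Slot n → Finset (Fin n)
  card_W3T : ∀ sl, (W3T sl).card = 3 * t + 1
  faulty : Finset (Fin n)
  card_faulty : faulty.card ≤ t

/-! ### The random choices -/

/-- The random choices: the value of the oracle `R` on a slot, and the peers that a process
selects when it probes on behalf of a slot. -/
inductive Draw (n : ℕ) where
  | witness (sl : Slot n)
  | target (p : Fin n) (sl : Slot n)

/-- An outcome of all random choices. -/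
abbrev Coins (n : ℕ) := Draw n → Finset (Fin n)

/-- The possible outcomes of a draw: any `κ` processes for the active witness set, any `δ` members
of `W3T sl` for the probed peers. -/
def Config.choices (C : Config) : Draw C.n → Finset (Finset (Fin C.n))
  | .witness _ => Finset.powersetCard C.κ Finset.univ
  | .target _ sl => Finset.powersetCard C.δ (C.W3T sl)

/-- All draws are independent, and each of them is uniform on its possible outcomes. -/
noncomputable def Config.law (C : Config) : Measure (Coins C.n) :=
  Measure.infinitePi fun d => uniformOn (C.choices d : Set (Finset (Fin C.n)))

theorem Config.choices_nonempty (C : Config) (d : Draw C.n) : (C.choices d).Nonempty := by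
  cases d with
  | witness sl => exact Finset.powersetCard_nonempty.2 (by simpa using C.κ_le)
  | target p sl => exact Finset.powersetCard_nonempty.2 (by rw [C.card_W3T]; exact C.δ_le)

instance Config.isProbabilityMeasure_choices (C : Config) (d : Draw C.n) :
    IsProbabilityMeasure (uniformOn (C.choices d : Set (Finset (Fin C.n)))) :=
  isProbabilityMeasure_uniformOn (Finset.finite_toSet _) (C.choices_nonempty d)

instance Config.isProbabilityMeasure_law (C : Config) : IsProbabilityMeasure C.law := by
  unfold Config.law; infer_instance

/-! ### Global states of an execution -/

/-- The state of all correct processes. Signatures are symbolic: a correct process has signed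
exactly the statements that are recorded here, and a faulty process can sign anything. -/
structure State (n : ℕ) (Payload Hash : Type*) where
  /-- the number of messages multicast so far by a correct process -/
  sent : Fin n → ℕ
  /-- the hash that a correct sender signed for one of its slots -/
  signed : Slot n → Option Hash
  /-- the slots for which the correct sender has reverted to the recovery regime -/
  reverted : Finset (Slot n)
  /-- the signed hash that a correct process first received for a slot, in a message of any kind -/
  heard : Fin n × Slot n → Option Hash
  /-- `s ∈ alerted`: a correct process has sent to all processes an alert that exposes `s` -/
  alerted : Finset (Fin n)
  /-- `(p, s) ∈ shun`: the correct process `p` knows that `s` is faulty -/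
  shun : Finset (Fin n × Fin n)
  /-- `(p, sl) ∈ probing`: `p` has selected its targets for `sl` and has sent them informs -/
  probing : Finset (Fin n × Slot n)
  /-- `(p, sl, k) ∈ probed`: enough time has passed for an inform for `sl` from the correct `p`
  to reach the correct `k`, if `p` has sent one to `k` -/
  probed : Finset (Fin n × Slot n × Fin n)
  /-- `(p, sl, k) ∈ verified`: `k` has replied with a verify to the inform from `p` -/
  verified : Finset (Fin n × Slot n × Fin n)
  /-- 3T-regular messages accepted, whose acknowledgment is being delayed -/
  pending : Finset (Fin n × Slot n)
  /-- AV-acknowledgments signed by correct processes -/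
  avAcks : Finset (Fin n × Slot n × Hash)
  /-- 3T-acknowledgments signed by correct processes -/
  tAcks : Finset (Fin n × Slot n × Hash)
  /-- `last (p, s)`: the sequence number of the last message of `s` delivered by `p` -/
  last : Fin n × Fin n → ℕ
  /-- all deliveries by correct processes -/
  delivered : List (Fin n × Message n Payload)

/-- Nothing has happened yet. -/
def State.init (n : ℕ) (Payload Hash : Type*) : State n Payload Hash where
  sent := fun _ => 0
  signed := fun _ => none
  reverted := ∅
  heard := fun _ => none
  alerted := ∅
  shun := ∅
  probing := ∅
  probed := ∅
  verified := ∅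
  pending := ∅
  avAcks := ∅
  tAcks := ∅
  last := fun _ => 0
  delivered := []

/-- The next event of the execution. It is the adversary who controls the faulty processes, the
application inputs, the relative speeds and all message delays. -/
inductive Action (n : ℕ) (Payload Hash : Type*) where
  /-- do nothing -/
  | idle
  /-- ask the oracle `R` for the active witness set of a slot -/
  | query (sl : Slot n)
  /-- the correct process `m.sender` performs WAN-multicast of `m` -/
  | multicast (m : Message n Payload)
  /-- the timeout of the no-failure regime expires at the correct sender of `sl` -/
  | timeout (sl : Slot n)
  /-- `p` receives from the sender of `sl` a signed AV-regular message for hash `x` -/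
  | avRegular (p : Fin n) (sl : Slot n) (x : Hash)
  /-- `p` receives from the sender of `sl` a signed 3T-regular message for hash `x` -/
  | tRegular (p : Fin n) (sl : Slot n) (x : Hash)
  /-- the faulty process `f` sends `p` an inform for `sl` and hash `x` -/
  | inform (f p : Fin n) (sl : Slot n) (x : Hash)
  /-- the inform for `sl` from the correct `p` to the correct `k`, if there is one, arrives -/
  | probe (p k : Fin n) (sl : Slot n)
  /-- the faulty process `f` sends `p` a verify for `sl` -/
  | verify (f p : Fin n) (sl : Slot n)
  /-- `p` collects the verifications that it has got for `sl`, and acknowledges if all are there -/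
  | avAck (p : Fin n) (sl : Slot n)
  /-- the delay of the 3T-acknowledgment of `p` for `sl` is over -/
  | tAck (p : Fin n) (sl : Slot n)
  /-- a pending alert that exposes `s` arrives at `p` -/
  | hear (p s : Fin n)
  /-- `p` receives a deliver message for `m` with AV-acknowledgments -/
  | deliverAV (p : Fin n) (m : Message n Payload)
  /-- `p` receives a deliver message for `m` with 3T-acknowledgments from the processes in `S` -/
  | deliver3T (p : Fin n) (m : Message n Payload) (S : Finset (Fin n))

/-- The message that occurs in full in an event. -/
def Action.message? {n : ℕ} {Payload Hash : Type*} :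
    Action n Payload Hash → Option (Message n Payload)
  | .multicast m => some m
  | .deliverAV _ m => some m
  | .deliver3T _ m _ => some m
  | _ => none

/-- What the adversary observes of an event. -/
inductive Obs (n : ℕ) where
  | silent
  /-- the answer of the oracle -/
  | witnesses (W : Finset (Fin n))
  /-- a correct process starts probing; the faulty members of its target set are informed -/
  | informed (F : Finset (Fin n))
  /-- a faulty process gets a verify as a reply -/
  | verified
  /-- a correct process issues an acknowledgment -/
  | acked
  /-- a correct process sends an alert -/
  | alert
  /-- a correct process delivers a message -/
  | delivered

/-- What a correct process does with a signed statement (slot, hash). -/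
inductive Receipt where
  | ignored
  | conflict
  | accepted

section Protocol

variable (C : Config) {Payload Hash : Type*} [DecidableEq Hash]

/-- `x` carries a valid signature of the sender of `sl`: faulty senders may sign anything,
and signatures of correct senders cannot be forged. -/
def Signed (σ : State C.n Payload Hash) (sl : Slot C.n) (x : Hash) : Prop :=
  sl.1 ∈ C.faulty ∨ σ.signed sl = some x

instance (σ : State C.n Payload Hash) (sl : Slot C.n) (x : Hash) : Decidable (Signed C σ sl x) := by
  unfold Signed; infer_instance

/-- The correct process `p` receives the statement that the sender of `sl` signed the hash `x`.
A process that knows the sender to be faulty ignores it; a process that has received a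
conflicting statement earlier sends an alert; otherwise the statement is recorded. -/
def receive (σ : State C.n Payload Hash) (p : Fin C.n) (sl : Slot C.n) (x : Hash) :
    State C.n Payload Hash × Receipt :=
  if (p, sl.1) ∈ σ.shun then (σ, .ignored)
  else match σ.heard (p, sl) with
    | none => ({ σ with heard := Function.update σ.heard (p, sl) (some x) }, .accepted)
    | some y =>
      if y = x then (σ, .accepted)
      else ({ σ with
              alerted := insert sl.1 σ.alerted
              shun := insert (p, sl.1) σ.shun }, .conflict)

/-- The set of AV-acknowledgments for `x` is complete: it covers the whole active witness set `W`
of `sl`, and the sender's signature that it has to contain exists. -/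
def ValidAV (σ : State C.n Payload Hash) (W : Finset (Fin C.n)) (sl : Slot C.n) (x : Hash) : Prop :=
  Signed C σ sl x ∧ ∀ w ∈ W, w ∈ C.faulty ∨ (w, sl, x) ∈ σ.avAcks

instance (σ : State C.n Payload Hash) (W : Finset (Fin C.n)) (sl : Slot C.n) (x : Hash) :
    Decidable (ValidAV C σ W sl x) := by
  unfold ValidAV; infer_instance

/-- `S` is a recovery set for `sl`: `2t + 1` of the `3t + 1` designated processes. -/
def RecoverySet (sl : Slot C.n) (S : Finset (Fin C.n)) : Prop :=
  S ⊆ C.W3T sl ∧ S.card = 2 * C.t + 1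

instance (sl : Slot C.n) (S : Finset (Fin C.n)) : Decidable (RecoverySet C sl S) := by
  unfold RecoverySet; infer_instance

/-- The 3T-acknowledgments for `x` from the processes in `S` form a valid set. -/
def Valid3T (σ : State C.n Payload Hash) (S : Finset (Fin C.n)) (sl : Slot C.n) (x : Hash) : Prop :=
  RecoverySet C sl S ∧ ∀ w ∈ S, w ∈ C.faulty ∨ (w, sl, x) ∈ σ.tAcks

instance (σ : State C.n Payload Hash) (S : Finset (Fin C.n)) (sl : Slot C.n) (x : Hash) :
    Decidable (Valid3T C σ S sl x) := by
  unfold Valid3T; infer_instance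

/-- `p` performs WAN-deliver of `m`. -/
def recordDelivery (σ : State C.n Payload Hash) (p : Fin C.n) (m : Message C.n Payload) :
    State C.n Payload Hash :=
  { σ with
    last := Function.update σ.last (p, m.sender) m.seq
    delivered := (p, m) :: σ.delivered }

variable (H : Message C.n Payload → Hash)

/-- One event of the protocol, for the outcome `ω` of the random choices. An event that is not
possible in the current state changes nothing. -/
def step (ω : Coins C.n) (σ : State C.n Payload Hash) :
    Action C.n Payload Hash → State C.n Payload Hash × Obs C.n
  | .idle => (σ, .silent)
  | .query sl => (σ, .witnesses (ω (.witness sl)))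
  | .multicast m =>
    -- a correct process numbers its messages consecutively, starting with 1
    if m.sender ∉ C.faulty ∧ m.seq = σ.sent m.sender + 1 then
      ({ σ with
         sent := Function.update σ.sent m.sender m.seq
         signed := Function.update σ.signed m.slot (some (H m)) }, .silent)
    else (σ, .silent)
  | .timeout sl =>
    if sl.1 ∉ C.faulty ∧ (σ.signed sl).isSome then
      ({ σ with reverted := insert sl σ.reverted }, .silent)
    else (σ, .silent)
  | .avRegular p sl x =>
    -- a correct sender addresses the members of the active witness set only
    if p ∉ C.faulty ∧ Signed C σ sl x ∧ (sl.1 ∈ C.faulty ∨ p ∈ ω (.witness sl)) then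
      match receive C σ p sl x with
      | (σ', .ignored) => (σ', .silent)
      | (σ', .conflict) => (σ', .alert)
      | (σ', .accepted) =>
        if (p, sl) ∈ σ'.probing then (σ', .silent)
        else ({ σ' with probing := insert (p, sl) σ'.probing },
          .informed (ω (.target p sl) ∩ C.faulty))
    else (σ, .silent)
  | .tRegular p sl x =>
    -- a correct sender addresses `W3T sl` only, and only after its timeout
    if p ∉ C.faulty ∧ Signed C σ sl x ∧
        (sl.1 ∈ C.faulty ∨ (sl ∈ σ.reverted ∧ p ∈ C.W3T sl)) then
      match receive C σ p sl x with
      | (σ', .ignored) => (σ', .silent)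
      | (σ', .conflict) => (σ', .alert)
      | (σ', .accepted) => ({ σ' with pending := insert (p, sl) σ'.pending }, .silent)
    else (σ, .silent)
  | .inform f p sl x =>
    if f ∈ C.faulty ∧ p ∉ C.faulty ∧ Signed C σ sl x then
      match receive C σ p sl x with
      | (σ', .ignored) => (σ', .silent)
      | (σ', .conflict) => (σ', .alert)
      | (σ', .accepted) => (σ', .verified)
    else (σ, .silent)
  | .probe p k sl =>
    -- the adversary cannot see whether there is such a message, nor the reply to it
    if p ∉ C.faulty ∧ k ∉ C.faulty ∧ (p, sl) ∈ σ.probing ∧ (p, sl, k) ∉ σ.probed then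
      let σ₁ := { σ with probed := insert (p, sl, k) σ.probed }
      match σ.heard (p, sl) with
      | none => (σ₁, .silent)
      | some x =>
        if k ∈ ω (.target p sl) then
          match receive C σ₁ k sl x with
          | (σ', .ignored) => (σ', .silent)
          | (σ', .conflict) => (σ', .alert)
          | (σ', .accepted) =>
            ({ σ' with verified := insert (p, sl, k) σ'.verified }, .silent)
        else (σ₁, .silent)
    else (σ, .silent)
  | .verify f p sl =>
    if f ∈ C.faulty ∧ p ∉ C.faulty ∧ (p, sl) ∈ σ.probing then
      ({ σ with verified := insert (p, sl, f) σ.verified }, .silent)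
    else (σ, .silent)
  | .avAck p sl =>
    -- The second line: the time of this event does not depend on which peers were selected, since
    -- it comes after the delays of the exchanges with all the correct peers that might have been.
    if p ∉ C.faulty ∧ (p, sl) ∈ σ.probing ∧ (p, sl.1) ∉ σ.shun ∧
        (∀ k ∈ C.W3T sl \ C.faulty, (p, sl, k) ∈ σ.probed) ∧
        (∀ k ∈ ω (.target p sl), (p, sl, k) ∈ σ.verified) then
      match σ.heard (p, sl) with
      | none => (σ, .silent)
      | some x => ({ σ with avAcks := insert (p, sl, x) σ.avAcks }, .acked)
    else (σ, .silent)
  | .tAck p sl =>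
    -- Alerts arrive in time: one that was sent before the delay is over prevents this event.
    if p ∉ C.faulty ∧ (p, sl) ∈ σ.pending ∧ sl.1 ∉ σ.alerted then
      match σ.heard (p, sl) with
      | none => (σ, .silent)
      | some x => ({ σ with tAcks := insert (p, sl, x) σ.tAcks }, .acked)
    else (σ, .silent)
  | .hear p s =>
    if s ∈ σ.alerted then ({ σ with shun := insert (p, s) σ.shun }, .silent) else (σ, .silent)
  | .deliverAV p m =>
    if p ∉ C.faulty ∧ σ.last (p, m.sender) + 1 = m.seq ∧
        ValidAV C σ (ω (.witness m.slot)) m.slot (H m) then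
      (recordDelivery C σ p m, .delivered)
    else (σ, .silent)
  | .deliver3T p m S =>
    if p ∉ C.faulty ∧ σ.last (p, m.sender) + 1 = m.seq ∧ Valid3T C σ S m.slot (H m) then
      (recordDelivery C σ p m, .delivered)
    else (σ, .silent)

/-! ### Executions against an adversary -/

/-- An adversary chooses the next event from what it has observed so far (the latest observation
comes first). Its own earlier events are determined by the same list. -/
abbrev Adversary (C : Config) (Payload Hash : Type*) := List (Obs C.n) → Action C.n Payload Hash

/-- The state and the adversary's observations after a number of events. -/
def run (A : Adversary C Payload Hash) (ω : Coins C.n) :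
    ℕ → State C.n Payload Hash × List (Obs C.n)
  | 0 => (State.init C.n Payload Hash, [])
  | k + 1 =>
    let r := run A ω k
    let r' := step C H ω r.1 (A r.2)
    (r'.1, r'.2 :: r.2)

/-- The adversary never comes up with two different messages that have the same hash. -/
def CollisionFree (A : Adversary C Payload Hash) : Prop :=
  ∀ (ω : Coins C.n) (k l : ℕ) (m m' : Message C.n Payload),
    (A (run C H A ω k).2).message? = some m → (A (run C H A ω l).2).message? = some m' →
    H m = H m' → m = m'

/-- Some two correct processes deliver different messages for the slot `sl`. -/
def Conflict (A : Adversary C Payload Hash) (sl : Slot C.n) : Set (Coins C.n) :=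
  {ω | ∃ (k : ℕ) (p p' : Fin C.n) (m m' : Message C.n Payload),
    p ∉ C.faulty ∧ p' ∉ C.faulty ∧ m.slot = sl ∧ m'.slot = sl ∧
    (p, m) ∈ (run C H A ω k).1.delivered ∧ (p', m') ∈ (run C H A ω k).1.delivered ∧ m ≠ m'}

/-- All members of the active witness set of `sl` are faulty. -/
def WitnessesFaulty (sl : Slot C.n) : Set (Coins C.n) :=
  {ω | ω (.witness sl) ⊆ C.faulty}

end Protocol

end ActiveT

open ActiveT

/-! A correct process keeps the hash it first heard for a slot and acknowledges only that hash. Two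
recovery sets share a correct process, and a correct member `w` of the active witness set belongs to
every complete set of AV-acknowledgments. So a conflict needs `w` to acknowledge one hash and a
recovery set `S` another (`exists_of_conflict`), and then every probe of `w` has missed the correct
part of `S`.

For a fixed `S` this has small probability, but the adversary chooses `S` adaptively. Hence all
draws are frozen except the targets of `w`, and for these also the faulty part `G`, which the
adversary sees. Consider the outcomes that still end in a conflict, and take the earliest time at
which a recovery set `S` is complete in any of them. No outcome has exposed the sender by then,
because an exposed sender gets no new 3T-acknowledgment. While the sender is unexposed, every probe
that arrives is accepted, and executions that differ only in the correct targets of `w` look the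
same to the adversary and have the same acknowledgments (`similar_run`). So `S` is complete in all
of them, and all their target sets avoid its correct members (`exists_disjoint_target`).

Thus `S` may depend on `G`, but on nothing else about the targets. With `F` the faulty part of `W3T
sl`, the correct targets are confined to at most `t` processes for each `G ⊆ F`. Vandermonde's
identity sums this over `G` to at most `(|F| + t).choose δ ≤ (2t).choose δ` bad target sets
(`card_le_choose_of_confined`), out of `(3t + 1).choose δ`. Redrawing one independent coordinate
(`infinitePi_le_mul_of_update`) makes this count a probability bound for each value of the active
witness set that has a correct member; summing over these values gives the conditional bound. The
overall bound follows as `p + q (1 - p)` is monotone in `p` and `q` on the unit interval. -/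

namespace ActiveT

/-! ### Invariants and monotonicity of executions; quorum intersection. -/

section Runs

variable {C : Config} {Payload Hash : Type*} [DecidableEq Hash]

/-- The facts that link the records of the correct processes to each other in every execution. -/
structure Invariant (C : Config) {Payload Hash : Type*} (ω : Coins C.n)
    (σ : State C.n Payload Hash) : Prop where
  alerted_of_shun : ∀ p s, (p, s) ∈ σ.shun → s ∈ σ.alerted
  heard_of_probing : ∀ i ∈ σ.probing, σ.heard i ≠ none
  heard_of_pending : ∀ i ∈ σ.pending, σ.heard i ≠ none
  heard_of_avAcks : ∀ p sl x, (p, sl, x) ∈ σ.avAcks → σ.heard (p, sl) = some x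
  verified_of_avAcks : ∀ p sl x, (p, sl, x) ∈ σ.avAcks →
    ∀ k ∈ ω (.target p sl), (p, sl, k) ∈ σ.verified
  heard_of_tAcks : ∀ p sl x, (p, sl, x) ∈ σ.tAcks → σ.heard (p, sl) = some x
  heard_of_verified : ∀ p sl k, (p, sl, k) ∈ σ.verified → k ∉ C.faulty →
    ∃ x, σ.heard (p, sl) = some x ∧ σ.heard (k, sl) = some x
  -- Without exposure no probe fails, so completeness of the verifications reveals nothing about
  -- which correct peers were selected.
  verified_of_probed : ∀ p sl k, sl.1 ∉ σ.alerted → (p, sl, k) ∈ σ.probed →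
    k ∈ ω (.target p sl) → (p, sl, k) ∈ σ.verified

omit [DecidableEq Hash] in
theorem Invariant.init (ω : Coins C.n) : Invariant C ω (State.init C.n Payload Hash) := by
  constructor <;> simp [State.init]

/-- The possible outcomes of the receipt of a signed statement. -/
theorem receive_cases (σ : State C.n Payload Hash) (p : Fin C.n) (sl : Slot C.n) (x : Hash) :
    ((p, sl.1) ∈ σ.shun ∧ receive C σ p sl x = (σ, .ignored)) ∨
    ((p, sl.1) ∉ σ.shun ∧ σ.heard (p, sl) = none ∧ receive C σ p sl x =
      ({ σ with heard := Function.update σ.heard (p, sl) (some x) }, .accepted)) ∨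
    ((p, sl.1) ∉ σ.shun ∧ σ.heard (p, sl) = some x ∧ receive C σ p sl x = (σ, .accepted)) ∨
    ((p, sl.1) ∉ σ.shun ∧ (∃ y, σ.heard (p, sl) = some y ∧ y ≠ x) ∧ receive C σ p sl x =
      ({ σ with
          alerted := insert sl.1 σ.alerted
          shun := insert (p, sl.1) σ.shun }, .conflict)) := by
  unfold receive
  split_ifs with h
  · exact .inl ⟨h, rfl⟩
  · right
    split
    · next h' => exact .inl ⟨h, h', rfl⟩
    · next y h' =>
      right
      split_ifs with e
      · exact .inl ⟨h, e ▸ h', rfl⟩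
      · exact .inr ⟨h, ⟨y, h', e⟩, rfl⟩

/-- How the state may develop. -/
structure Extends (σ σ' : State C.n Payload Hash) : Prop where
  heard : ∀ i x, σ.heard i = some x → σ'.heard i = some x
  alerted : σ.alerted ⊆ σ'.alerted
  avAcks : σ.avAcks ⊆ σ'.avAcks
  tAcks : σ.tAcks ⊆ σ'.tAcks
  -- This is the form in which the timeliness of alerts enters the proof.
  fresh_tAcks : ∀ p sl x, (p, sl, x) ∈ σ'.tAcks → (p, sl, x) ∈ σ.tAcks ∨ sl.1 ∉ σ'.alerted

omit [DecidableEq Hash] in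
theorem Extends.refl (σ : State C.n Payload Hash) : Extends σ σ :=
  ⟨fun _ _ h => h, subset_rfl, subset_rfl, subset_rfl, fun _ _ _ h => .inl h⟩

theorem receive_extends (σ : State C.n Payload Hash) (p : Fin C.n) (sl : Slot C.n) (x : Hash) :
    Extends σ (receive C σ p sl x).1 := by
  rcases receive_cases σ p sl x with ⟨h, e⟩ | ⟨h, h', e⟩ | ⟨h, h', e⟩ | ⟨h, h', e⟩ <;> rw [e]
  · exact .refl σ
  · refine ⟨fun i y hi => ?_, subset_rfl, subset_rfl, subset_rfl, fun _ _ _ h => .inl h⟩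
    have : i ≠ (p, sl) := by rintro rfl; simp [h'] at hi
    simpa [Function.update_of_ne this] using hi
  · exact .refl σ
  · exact ⟨fun _ _ h => h, Finset.subset_insert _ _, subset_rfl, subset_rfl, fun _ _ _ h => .inl h⟩

theorem Invariant.receive {ω : Coins C.n} {σ : State C.n Payload Hash} (hσ : Invariant C ω σ)
    (p : Fin C.n) (sl : Slot C.n) (x : Hash) : Invariant C ω (receive C σ p sl x).1 := by
  have hx := receive_extends σ p sl x
  have hs (i) (h : σ.heard i ≠ none) : (ActiveT.receive C σ p sl x).1.heard i ≠ none := by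
    obtain ⟨y, hy⟩ := Option.ne_none_iff_exists'.1 h
    simp [hx.heard i y hy]
  have hm := hx.heard
  rcases receive_cases σ p sl x with ⟨h, e⟩ | ⟨h, h', e⟩ | ⟨h, h', e⟩ | ⟨h, h', e⟩ <;>
    rw [e] at hs hm ⊢
  · exact hσ
  · exact ⟨hσ.1, fun i hi => hs i (hσ.2 i hi), fun i hi => hs i (hσ.3 i hi),
      fun p sl x h => hm _ _ (hσ.4 p sl x h), hσ.5, fun p sl x h => hm _ _ (hσ.6 p sl x h),
      fun p sl k h hk => (hσ.7 p sl k h hk).imp fun x h => ⟨hm _ _ h.1, hm _ _ h.2⟩, hσ.8⟩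
  · exact hσ
  · refine ⟨fun q s hq => ?_, hσ.2, hσ.3, hσ.4, hσ.5, hσ.6, hσ.7, fun q sl' k hq => ?_⟩
    · have := hσ.1 q s
      simp only [Finset.mem_insert, Prod.mk.injEq] at hq ⊢
      tauto
    · exact hσ.8 q sl' k fun h => hq (Finset.mem_insert_of_mem h)

/-- A process that accepts a statement has it on record. -/
theorem heard_of_receive_eq_accepted {σ σ' : State C.n Payload Hash} {p : Fin C.n} {sl : Slot C.n}
    {x : Hash} (h : receive C σ p sl x = (σ', .accepted)) : σ'.heard (p, sl) = some x := by
  rcases receive_cases σ p sl x with ⟨_, e⟩ | ⟨_, h', e⟩ | ⟨_, h', e⟩ | ⟨_, h', e⟩ <;>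
    rw [e] at h <;> simp at h <;> subst h <;> simp [h']

/-- A conflict raises the alert itself, and a statement is ignored only by a process that shuns the
sender, which by `hσ` presupposes an earlier alert. -/
theorem alerted_of_receive_ne_accepted {σ σ' : State C.n Payload Hash}
    (hσ : ∀ p s, (p, s) ∈ σ.shun → s ∈ σ.alerted) {p : Fin C.n} {sl : Slot C.n} {x : Hash} {r : Receipt}
    (h : receive C σ p sl x = (σ', r)) (hr : r ≠ .accepted) : sl.1 ∈ σ'.alerted := by
  rcases receive_cases σ p sl x with ⟨h₀, e⟩ | ⟨_, h', e⟩ | ⟨_, h', e⟩ | ⟨_, h', e⟩ <;>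
    rw [e] at h <;> simp at h <;> obtain ⟨rfl, rfl⟩ := h <;> simp at hr ⊢
  exact hσ _ _ h₀

theorem receive_eq_of_fields (σ : State C.n Payload Hash) (p : Fin C.n) (sl : Slot C.n) (x : Hash) :
    ∃ h a s, (receive C σ p sl x).1 = { σ with heard := h, alerted := a, shun := s } := by
  rcases receive_cases σ p sl x with ⟨_, e⟩ | ⟨_, h', e⟩ | ⟨_, h', e⟩ | ⟨_, h', e⟩ <;> rw [e]
  exacts [⟨_, _, _, rfl⟩, ⟨_, _, _, rfl⟩, ⟨_, _, _, rfl⟩, ⟨_, _, _, rfl⟩]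

variable (H : Message C.n Payload → Hash)

/-- Only `tAck` adds 3T-acknowledgments, and its guard excludes exposed senders; that gives
`fresh_tAcks`. Records are never overwritten because `receive` writes only where there is none. -/
theorem step_extends (ω : Coins C.n) (σ : State C.n Payload Hash) (a : Action C.n Payload Hash) :
    Extends σ (step C H ω σ a).1 := by
  have hr (p sl x σ' r) (h : receive C σ p sl x = (σ', r)) : Extends σ σ' := by
    have := receive_extends σ p sl x; rwa [h] at this
  have R := Extends.refl σ
  cases a with
  | idle => exact R
  | query sl => exact R
  | multicast m => simp only [step]; split_ifs <;> exact ⟨R.1, R.2, R.3, R.4, R.5⟩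
  | timeout sl => simp only [step]; split_ifs <;> exact ⟨R.1, R.2, R.3, R.4, R.5⟩
  | avRegular p sl x =>
    simp only [step]
    split_ifs
    · split <;> next σ' h =>
        have R := hr _ _ _ _ _ h
        first
          | exact R
          | (split_ifs <;> exact ⟨R.1, R.2, R.3, R.4, R.5⟩)
    · exact R
  | tRegular p sl x =>
    simp only [step]
    split_ifs
    · split <;> next σ' h =>
        have R := hr _ _ _ _ _ h
        exact ⟨R.1, R.2, R.3, R.4, R.5⟩
    · exact R
  | inform f p sl x =>
    simp only [step]
    split_ifs
    · split <;> next σ' h => exact hr _ _ _ _ _ h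
    · exact R
  | probe p k sl =>
    simp only [step]
    split
    · split
      · exact ⟨R.1, R.2, R.3, R.4, R.5⟩
      · next x hx =>
        split
        · split <;> next σ' h =>
            have R := receive_extends { σ with probed := insert (p, sl, k) σ.probed } k sl x
            rw [h] at R
            exact ⟨R.1, R.2, R.3, R.4, R.5⟩
        · exact ⟨R.1, R.2, R.3, R.4, R.5⟩
    · exact R
  | verify f p sl => simp only [step]; split_ifs <;> exact ⟨R.1, R.2, R.3, R.4, R.5⟩
  | avAck p sl =>
    simp only [step]
    split_ifs
    · split
      · exact R
      · exact ⟨R.1, R.2, Finset.subset_insert _ _, R.4, R.5⟩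
    · exact R
  | tAck p sl =>
    simp only [step]
    split_ifs with hc
    · split
      · exact R
      · refine ⟨R.1, R.2, R.3, Finset.subset_insert _ _, fun q sl' y h => ?_⟩
        simp only [Finset.mem_insert, Prod.mk.injEq] at h
        rcases h with ⟨rfl, rfl, rfl⟩ | h
        · exact .inr hc.2.2
        · exact .inl h
    · exact R
  | hear p s => simp only [step]; split_ifs <;> exact ⟨R.1, R.2, R.3, R.4, R.5⟩
  | deliverAV p m => simp only [step]; split_ifs <;> exact ⟨R.1, R.2, R.3, R.4, R.5⟩
  | deliver3T p m S => simp only [step]; split_ifs <;> exact ⟨R.1, R.2, R.3, R.4, R.5⟩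

/-- The delicate event is `probe`: it either leaves the same hash on record at both ends, or exposes
the sender, or concerns a process that was not selected. -/
theorem Invariant.step {ω : Coins C.n} {σ : State C.n Payload Hash} (hσ : Invariant C ω σ)
    (a : Action C.n Payload Hash) : Invariant C ω (step C H ω σ a).1 := by
  have hr (p sl x σ' r) (h : ActiveT.receive C σ p sl x = (σ', r)) : Invariant C ω σ' := by
    have := hσ.receive p sl x; rwa [h] at this
  cases a with
  | idle => exact hσ
  | query sl => exact hσ
  | multicast m =>
    simp only [ActiveT.step]; split_ifs <;> exact ⟨hσ.1, hσ.2, hσ.3, hσ.4, hσ.5, hσ.6, hσ.7, hσ.8⟩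
  | timeout sl =>
    simp only [ActiveT.step]; split_ifs <;> exact ⟨hσ.1, hσ.2, hσ.3, hσ.4, hσ.5, hσ.6, hσ.7, hσ.8⟩
  | avRegular p sl x =>
    simp only [ActiveT.step]
    split_ifs
    · split <;> next σ' h =>
        have I := hr _ _ _ _ _ h
        first
          | exact I
          | split_ifs
            · exact I
            · refine ⟨I.1, fun i hi => ?_, I.3, I.4, I.5, I.6, I.7, I.8⟩
              rcases Finset.mem_insert.1 hi with rfl | hi
              · simp [heard_of_receive_eq_accepted h]
              · exact I.2 i hi
    · exact hσ
  | tRegular p sl x =>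
    simp only [ActiveT.step]
    split_ifs
    · split <;> next σ' h =>
        have I := hr _ _ _ _ _ h
        first
          | exact I
          | refine ⟨I.1, I.2, fun i hi => ?_, I.4, I.5, I.6, I.7, I.8⟩
            rcases Finset.mem_insert.1 hi with rfl | hi
            · simp [heard_of_receive_eq_accepted h]
            · exact I.3 i hi
    · exact hσ
  | inform f p sl x =>
    simp only [ActiveT.step]
    split_ifs
    · split <;> next σ' h => exact hr _ _ _ _ _ h
    · exact hσ
  | probe p k sl =>
    simp only [ActiveT.step]
    split
    · next hc =>
      obtain ⟨hp, hk, hpr, hnew⟩ := hc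
      split
      · next hx => exact absurd hx (hσ.2 _ hpr)
      · next x hx =>
        split
        · have I' := hσ.receive k sl x
          have hE := receive_extends σ k sl x
          -- `receive` never looks at `probed`, so marking the probe commutes with it and the
          -- invariant can be taken from the unmarked state.
          have hcomm : ActiveT.receive C { σ with probed := insert (p, sl, k) σ.probed } k sl x =
              ({ (ActiveT.receive C σ k sl x).1 with probed := insert (p, sl, k) σ.probed },
                (ActiveT.receive C σ k sl x).2) := by
            unfold ActiveT.receive
            dsimp only
            split_ifs
            · rfl
            · split
              · rfl
              · split_ifs <;> rfl
          obtain ⟨h, a, s, hf⟩ := receive_eq_of_fields σ k sl x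
          have hpd : (ActiveT.receive C σ k sl x).1.probed = σ.probed := by rw [hf]
          rw [hcomm]
          generalize e : ActiveT.receive C σ k sl x = r at *
          obtain ⟨σ', r⟩ := r
          dsimp only at *
          -- A rejected probe leaves the sender exposed, so `verified_of_probed` claims nothing for
          -- it.
          have key (hr : r ≠ .accepted) :
              Invariant C ω { σ' with probed := insert (p, sl, k) σ.probed } := by
            refine ⟨I'.1, I'.2, I'.3, I'.4, I'.5, I'.6, I'.7, fun q sl' k' hal hq => ?_⟩
            rcases Finset.mem_insert.1 hq with hq | hq
            · simp only [Prod.mk.injEq] at hq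
              obtain ⟨rfl, rfl, rfl⟩ := hq
              exact absurd (alerted_of_receive_ne_accepted hσ.1 e hr) hal
            · exact I'.8 q sl' k' hal (hpd ▸ hq)
          cases r with
          | ignored => exact key (by simp)
          | conflict => exact key (by simp)
          | accepted =>
            refine ⟨I'.1, I'.2, I'.3, I'.4, fun q sl' y hq k' hk' =>
              Finset.mem_insert_of_mem (I'.5 q sl' y hq k' hk'), I'.6,
              fun q sl' k' hq hk' => ?_, fun q sl' k' hal hq hk' => ?_⟩
            · rcases Finset.mem_insert.1 hq with hq | hq
              · simp only [Prod.mk.injEq] at hq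
                obtain ⟨rfl, rfl, rfl⟩ := hq
                have := heard_of_receive_eq_accepted e
                exact ⟨x, hE.heard _ _ hx, this⟩
              · exact I'.7 q sl' k' hq hk'
            · rcases Finset.mem_insert.1 hq with hq | hq
              · exact Finset.mem_insert.2 (.inl hq)
              · exact Finset.mem_insert_of_mem (I'.8 q sl' k' hal (hpd ▸ hq) hk')
        · next ht =>
          refine ⟨hσ.1, hσ.2, hσ.3, hσ.4, hσ.5, hσ.6, hσ.7, fun q sl' k' hal hq hk' => ?_⟩
          rcases Finset.mem_insert.1 hq with hq | hq
          · simp only [Prod.mk.injEq] at hq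
            obtain ⟨rfl, rfl, rfl⟩ := hq
            exact absurd hk' ht
          · exact hσ.8 q sl' k' hal hq hk'
    · exact hσ
  | verify f p sl =>
    simp only [ActiveT.step]
    split_ifs with hc
    · refine ⟨hσ.1, hσ.2, hσ.3, hσ.4, fun q sl' y hq k' hk' =>
        Finset.mem_insert_of_mem (hσ.5 q sl' y hq k' hk'), hσ.6, fun q sl' k' hq hk' => ?_,
        fun q sl' k' hal hq hk' => Finset.mem_insert_of_mem (hσ.8 q sl' k' hal hq hk')⟩
      rcases Finset.mem_insert.1 hq with hq | hq
      · simp only [Prod.mk.injEq] at hq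
        obtain ⟨rfl, rfl, rfl⟩ := hq
        exact absurd hc.1 hk'
      · exact hσ.7 q sl' k' hq hk'
    · exact hσ
  | avAck p sl =>
    simp only [ActiveT.step]
    split_ifs with hc
    · split
      · exact hσ
      · next x hx =>
        refine ⟨hσ.1, hσ.2, hσ.3, fun q sl' y hq => ?_, fun q sl' y hq => ?_, hσ.6, hσ.7, hσ.8⟩
        · rcases Finset.mem_insert.1 hq with hq | hq
          · simp only [Prod.mk.injEq] at hq
            obtain ⟨rfl, rfl, rfl⟩ := hq
            exact hx
          · exact hσ.4 q sl' y hq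
        · rcases Finset.mem_insert.1 hq with hq | hq
          · simp only [Prod.mk.injEq] at hq
            obtain ⟨rfl, rfl, rfl⟩ := hq
            exact hc.2.2.2.2
          · exact hσ.5 q sl' y hq
    · exact hσ
  | tAck p sl =>
    simp only [ActiveT.step]
    split_ifs with hc
    · split
      · exact hσ
      · next x hx =>
        refine ⟨hσ.1, hσ.2, hσ.3, hσ.4, hσ.5, fun q sl' y hq => ?_, hσ.7, hσ.8⟩
        rcases Finset.mem_insert.1 hq with hq | hq
        · simp only [Prod.mk.injEq] at hq
          obtain ⟨rfl, rfl, rfl⟩ := hq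
          exact hx
        · exact hσ.6 q sl' y hq
    · exact hσ
  | hear p s =>
    simp only [ActiveT.step]
    split_ifs with hc
    · refine ⟨fun q s' hq => ?_, hσ.2, hσ.3, hσ.4, hσ.5, hσ.6, hσ.7, hσ.8⟩
      rcases Finset.mem_insert.1 hq with hq | hq
      · simp only [Prod.mk.injEq] at hq
        obtain ⟨rfl, rfl⟩ := hq
        exact hc
      · exact hσ.1 q s' hq
    · exact hσ
  | deliverAV p m =>
    simp only [ActiveT.step]; split_ifs <;> exact ⟨hσ.1, hσ.2, hσ.3, hσ.4, hσ.5, hσ.6, hσ.7, hσ.8⟩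
  | deliver3T p m S =>
    simp only [ActiveT.step]; split_ifs <;> exact ⟨hσ.1, hσ.2, hσ.3, hσ.4, hσ.5, hσ.6, hσ.7, hσ.8⟩

variable (A : Adversary C Payload Hash)

theorem invariant_run (ω : Coins C.n) (k : ℕ) : Invariant C ω (run C H A ω k).1 := by
  induction k with
  | zero => exact .init ω
  | succ k ih => exact ih.step H _

theorem alerted_run_mono (ω : Coins C.n) :
    Monotone fun k => (run C H A ω k).1.alerted :=
  monotone_nat_of_le_succ fun _ => (step_extends H ω _ _).alerted

theorem tAcks_run_mono (ω : Coins C.n) :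
    Monotone fun k => (run C H A ω k).1.tAcks :=
  monotone_nat_of_le_succ fun _ => (step_extends H ω _ _).tAcks

theorem avAcks_run_mono (ω : Coins C.n) :
    Monotone fun k => (run C H A ω k).1.avAcks :=
  monotone_nat_of_le_succ fun _ => (step_extends H ω _ _).avAcks

/-- Deliveries are justified by acknowledgments, and the messages delivered are the adversary's. -/
theorem delivered_run (ω : Coins C.n) (k : ℕ) (p : Fin C.n) (m : Message C.n Payload)
    (h : (p, m) ∈ (run C H A ω k).1.delivered) :
    (∃ j, (A (run C H A ω j).2).message? = some m) ∧
    ((∀ w ∈ ω (.witness m.slot), w ∈ C.faulty ∨ (w, m.slot, H m) ∈ (run C H A ω k).1.avAcks) ∨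
      ∃ S, Valid3T C (run C H A ω k).1 S m.slot (H m)) := by
  induction k with
  | zero => simp [run, State.init] at h
  | succ k ih =>
    have hE := step_extends H ω (run C H A ω k).1 (A (run C H A ω k).2)
    have lift : (∀ w ∈ ω (.witness m.slot), w ∈ C.faulty ∨
          (w, m.slot, H m) ∈ (run C H A ω k).1.avAcks) ∨
        (∃ S, Valid3T C (run C H A ω k).1 S m.slot (H m)) →
        (∀ w ∈ ω (.witness m.slot), w ∈ C.faulty ∨
          (w, m.slot, H m) ∈ (run C H A ω (k + 1)).1.avAcks) ∨
        ∃ S, Valid3T C (run C H A ω (k + 1)).1 S m.slot (H m) := by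
      rintro (h | ⟨S, hS, h⟩)
      · exact .inl fun w hw => (h w hw).imp_right fun h => hE.avAcks h
      · exact .inr ⟨S, hS, fun w hw => (h w hw).imp_right fun h => hE.tAcks h⟩
    by_cases hk : (p, m) ∈ (run C H A ω k).1.delivered
    · exact ⟨(ih hk).1, lift (ih hk).2⟩
    have new : (A (run C H A ω k).2).message? = some m ∧
        ((∀ w ∈ ω (.witness m.slot), w ∈ C.faulty ∨
          (w, m.slot, H m) ∈ (run C H A ω k).1.avAcks) ∨
        ∃ S, Valid3T C (run C H A ω k).1 S m.slot (H m)) := by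
      simp only [run] at h
      generalize (run C H A ω k).1 = σ at *
      generalize A (run C H A ω k).2 = a at *
      have hr (σ : State C.n Payload Hash) (q sl x σ' r)
          (e : receive C σ q sl x = (σ', r)) : σ'.delivered = σ.delivered := by
        obtain ⟨_, _, _, hf⟩ := receive_eq_of_fields σ q sl x
        rw [e] at hf
        simp only at hf
        rw [hf]
      cases a with
      | deliverAV q m' =>
        simp only [step] at h
        split_ifs at h with hc
        · simp only [recordDelivery, List.mem_cons, Prod.mk.injEq, hk, or_false] at h
          obtain ⟨rfl, rfl⟩ := h
          exact ⟨rfl, .inl hc.2.2.2⟩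
        · exact absurd h hk
      | deliver3T q m' S =>
        simp only [step] at h
        split_ifs at h with hc
        · simp only [recordDelivery, List.mem_cons, Prod.mk.injEq, hk, or_false] at h
          obtain ⟨rfl, rfl⟩ := h
          exact ⟨rfl, .inr ⟨S, hc.2.2⟩⟩
        · exact absurd h hk
      | _ =>
        exfalso
        simp only [step] at h
        repeat' split at h
        all_goals first
          | exact hk h
          | (rename_i e; exact hk (hr _ _ _ _ _ _ e ▸ h))
          | (rename_i e _; exact hk (hr _ _ _ _ _ _ e ▸ h))
    exact ⟨⟨k, new.1⟩, lift new.2⟩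

/-- A recovery set has at least `2t + 1 - |faulty ∩ W3T|` correct members. -/
theorem RecoverySet.card_sdiff {sl : Slot C.n} {S : Finset (Fin C.n)} (h : RecoverySet C sl S) :
    2 * C.t + 1 ≤ (S \ C.faulty).card + (C.faulty ∩ C.W3T sl).card := by
  have h₁ := Finset.card_sdiff_add_card_inter S C.faulty
  have h₂ : (S ∩ C.faulty).card ≤ (C.faulty ∩ C.W3T sl).card := by
    refine Finset.card_le_card fun k hk => ?_
    rw [Finset.mem_inter] at hk ⊢
    exact ⟨hk.2, h.1 hk.1⟩
  have := h.2
  omega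

/-- The intersection has at least `2(2t + 1) - (3t + 1) = t + 1` members, more than there are faulty
processes. -/
theorem RecoverySet.exists_correct {sl : Slot C.n} {S S' : Finset (Fin C.n)}
    (h : RecoverySet C sl S) (h' : RecoverySet C sl S') : ∃ p ∈ S ∩ S', p ∉ C.faulty := by
  by_contra! hc
  have h₁ := Finset.card_union_add_card_inter S S'
  have h₂ := Finset.card_le_card (Finset.union_subset h.1 h'.1)
  have h₃ := Finset.card_le_card (fun p hp => hc p hp : S ∩ S' ⊆ C.faulty)
  have := C.card_faulty
  rw [C.card_W3T] at h₂
  have := h.2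
  have := h'.2
  omega

omit [DecidableEq Hash] in
theorem Invariant.eq_of_valid3T {ω : Coins C.n} {σ : State C.n Payload Hash}
    (hσ : Invariant C ω σ) {sl : Slot C.n} {S S' : Finset (Fin C.n)} {x x' : Hash}
    (h : Valid3T C σ S sl x) (h' : Valid3T C σ S' sl x') : x = x' := by
  obtain ⟨p, hp, hpf⟩ := h.1.exists_correct h'.1
  rw [Finset.mem_inter] at hp
  have h₁ := hσ.heard_of_tAcks _ _ _ ((h.2 p hp.1).resolve_left hpf)
  have h₂ := hσ.heard_of_tAcks _ _ _ ((h'.2 p hp.2).resolve_left hpf)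
  rw [h₁] at h₂
  exact Option.some_inj.1 h₂

omit [DecidableEq Hash] in
/-- The probes of a witness that acknowledges another statement miss the recovery set. -/
theorem Invariant.disjoint_of_valid3T {ω : Coins C.n} {σ : State C.n Payload Hash}
    (hσ : Invariant C ω σ) {sl : Slot C.n} {S : Finset (Fin C.n)} {w : Fin C.n} {x y : Hash}
    (hw : (w, sl, x) ∈ σ.avAcks) (h : Valid3T C σ S sl y) (hne : x ≠ y) :
    Disjoint (ω (.target w sl)) (S \ C.faulty) := by
  refine Finset.disjoint_left.2 fun k hk hkS => ?_
  rw [Finset.mem_sdiff] at hkS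
  obtain ⟨z, hz, hz'⟩ := hσ.heard_of_verified _ _ _ (hσ.verified_of_avAcks _ _ _ hw k hk) hkS.2
  rw [hσ.heard_of_avAcks _ _ _ hw, Option.some_inj] at hz
  rw [hσ.heard_of_tAcks _ _ _ ((h.2 k hkS.1).resolve_left hkS.2), Option.some_inj] at hz'
  exact hne (hz.trans hz'.symm)

/-- A conflict leaves an execution in which a correct witness `w` acknowledges a statement and
a recovery set acknowledges another one. -/
theorem exists_of_conflict (hA : CollisionFree C H A) {sl : Slot C.n} {ω : Coins C.n}
    (hω : ω ∈ Conflict C H A sl) {w : Fin C.n} (hw : w ∈ ω (.witness sl)) (hwf : w ∉ C.faulty) :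
    ∃ k S x y, x ≠ y ∧ (w, sl, x) ∈ (run C H A ω k).1.avAcks ∧
      Valid3T C (run C H A ω k).1 S sl y := by
  obtain ⟨k, p, p', m, m', -, -, hm, hm', hd, hd', hne⟩ := hω
  obtain ⟨⟨j, hj⟩, h⟩ := delivered_run H A ω k p m hd
  obtain ⟨⟨j', hj'⟩, h'⟩ := delivered_run H A ω k p' m' hd'
  have hH : H m ≠ H m' := fun e => hne (hA ω j j' m m' hj hj' e)
  rw [hm] at h
  rw [hm'] at h'
  have I := invariant_run H A ω k
  -- Two AV-deliveries would give `w` two records, and two 3T-deliveries would do so for a common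
  -- correct member; only the mixed cases survive.
  rcases h with h | ⟨S, hS⟩ <;> rcases h' with h' | ⟨S', hS'⟩
  · have h₁ := I.heard_of_avAcks _ _ _ ((h w hw).resolve_left hwf)
    have h₂ := I.heard_of_avAcks _ _ _ ((h' w hw).resolve_left hwf)
    rw [h₁, Option.some_inj] at h₂
    exact absurd h₂ hH
  · exact ⟨k, S', H m, H m', hH, (h w hw).resolve_left hwf, hS'⟩
  · exact ⟨k, S, H m', H m, hH.symm, (h' w hw).resolve_left hwf, hS⟩
  · exact absurd (I.eq_of_valid3T hS hS') hH

end Runs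

/-! ### Indistinguishability of executions until the sender is exposed. -/

section Simulation

variable {C : Config} {Payload Hash : Type*} [DecidableEq Hash]

/-- Two states that the adversary cannot tell apart. They may only differ in the effects of the
probes that the correct members of `W3T sl` got from `w`. -/
structure Similar (w : Fin C.n) (sl : Slot C.n) (σ₁ σ₂ : State C.n Payload Hash) : Prop where
  eq : σ₂ = { σ₁ with heard := σ₂.heard, verified := σ₂.verified }
  -- Discrepancies occur only at processes already marked as probed, so a fresh probe from `w` finds
  -- equal records.
  heard : ∀ i, σ₁.heard i = σ₂.heard i ∨
    i.2 = sl ∧ (w, sl, i.1) ∈ σ₁.probed ∧ (σ₁.heard i = none ∨ σ₂.heard i = none)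
  verified : ∀ p sl' k, k ∈ C.faulty ∨ (p, sl') ≠ (w, sl) →
    ((p, sl', k) ∈ σ₁.verified ↔ (p, sl', k) ∈ σ₂.verified)

omit [DecidableEq Hash] in
theorem Similar.refl (w : Fin C.n) (sl : Slot C.n) (σ : State C.n Payload Hash) :
    Similar w sl σ σ :=
  ⟨rfl, fun _ => .inl rfl, fun _ _ _ _ => Iff.rfl⟩

omit [DecidableEq Hash] in
-- A process that probes or has a pending 3T-acknowledgment has a record in both executions, so it
-- passes on or signs the same hash in both.
theorem Similar.heard_eq_of_ne_none {w : Fin C.n} {sl : Slot C.n} {σ₁ σ₂ : State C.n Payload Hash}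
    (h : Similar w sl σ₁ σ₂) {i : Fin C.n × Slot C.n} (h₁ : σ₁.heard i ≠ none)
    (h₂ : σ₂.heard i ≠ none) : σ₁.heard i = σ₂.heard i := by
  rcases h.heard i with h | ⟨-, -, h | h⟩
  exacts [h, absurd h h₁, absurd h h₂]

/-- Where the records differ, one is missing: either the statement is accepted in both states and
the records become equal, or it conflicts in one of them and exposes the sender of `sl`, contrary to
`h₁` or `h₂`. -/
theorem Similar.receive {w : Fin C.n} {sl : Slot C.n} {σ₁ σ₂ : State C.n Payload Hash}
    (h : Similar w sl σ₁ σ₂) (p : Fin C.n) (sl' : Slot C.n) (x : Hash)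
    (h₁ : sl.1 ∉ (receive C σ₁ p sl' x).1.alerted) (h₂ : sl.1 ∉ (receive C σ₂ p sl' x).1.alerted) :
    Similar w sl (receive C σ₁ p sl' x).1 (receive C σ₂ p sl' x).1 ∧
      (receive C σ₁ p sl' x).2 = (receive C σ₂ p sl' x).2 := by
  obtain ⟨he, hh, hv⟩ := h
  have hs : σ₂.shun = σ₁.shun := by rw [he]
  have ha : σ₂.alerted = σ₁.alerted := by rw [he]
  rcases receive_cases σ₁ p sl' x with ⟨s₁, e₁⟩ | ⟨s₁, g₁, e₁⟩ | ⟨s₁, g₁, e₁⟩ | ⟨s₁, ⟨y, g₁, n₁⟩, e₁⟩ <;>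
  rcases receive_cases σ₂ p sl' x with ⟨s₂, e₂⟩ | ⟨s₂, g₂, e₂⟩ | ⟨s₂, g₂, e₂⟩ | ⟨s₂, ⟨z, g₂, n₂⟩, e₂⟩ <;>
  rw [hs] at s₂ <;> first
    | exact absurd s₂ s₁
    | exact absurd s₁ s₂
    | rw [e₁] at h₁ ⊢
      rw [e₂] at h₂ ⊢
      dsimp only at h₁ h₂ ⊢
  · exact ⟨⟨he, hh, hv⟩, rfl⟩
  · refine ⟨⟨by rw [he], fun i => ?_, hv⟩, rfl⟩
    by_cases hi : i = (p, sl')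
    · subst hi; simp
    · simpa [Function.update_of_ne hi] using hh i
  · refine ⟨⟨by rw [he], fun i => ?_, hv⟩, rfl⟩
    by_cases hi : i = (p, sl')
    · subst hi; simp [g₂]
    · simpa [Function.update_of_ne hi] using hh i
  · rcases hh (p, sl') with hi | ⟨hi, -⟩
    · simp [g₁, g₂] at hi
    · dsimp only at hi
      subst hi
      exact absurd (Finset.mem_insert_self _ _) h₂
  · refine ⟨⟨by rw [he], fun i => ?_, hv⟩, rfl⟩
    by_cases hi : i = (p, sl')
    · subst hi; simp [g₁]
    · simpa [Function.update_of_ne hi] using hh i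
  · exact ⟨⟨he, hh, hv⟩, rfl⟩
  · rcases hh (p, sl') with hi | ⟨hi, -⟩
    · rw [g₁, g₂, Option.some_inj] at hi
      exact absurd hi.symm n₂
    · dsimp only at hi
      subst hi
      exact absurd (Finset.mem_insert_self _ _) h₂
  · rcases hh (p, sl') with hi | ⟨hi, -⟩
    · simp [g₁, g₂] at hi
    · dsimp only at hi
      subst hi
      exact absurd (Finset.mem_insert_self _ _) h₁
  · rcases hh (p, sl') with hi | ⟨hi, -⟩
    · rw [g₁, g₂, Option.some_inj] at hi
      exact absurd hi n₁
    · dsimp only at hi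
      subst hi
      exact absurd (Finset.mem_insert_self _ _) h₁
  · exact ⟨⟨by rw [he], hh, hv⟩, rfl⟩

omit [DecidableEq Hash] in
theorem Similar.symm {w : Fin C.n} {sl : Slot C.n} {σ₁ σ₂ : State C.n Payload Hash}
    (h : Similar w sl σ₁ σ₂) : Similar w sl σ₂ σ₁ := by
  have hp : σ₂.probed = σ₁.probed := by rw [h.eq]
  refine ⟨by rw [h.eq], fun i => ?_, fun p sl' k hk => (h.verified p sl' k hk).symm⟩
  rw [hp]
  exact (h.heard i).imp Eq.symm (.imp_right (.imp_right Or.symm))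

omit [DecidableEq Hash] in
theorem Similar.insert_verified {w : Fin C.n} {sl : Slot C.n} {σ₁ σ₂ : State C.n Payload Hash}
    (h : Similar w sl σ₁ σ₂) (v : Fin C.n × Slot C.n × Fin C.n) :
    Similar w sl { σ₁ with verified := insert v σ₁.verified }
      { σ₂ with verified := insert v σ₂.verified } := by
  refine ⟨by rw [h.eq], h.heard, fun p sl' k hk => ?_⟩
  simp only [Finset.mem_insert]
  exact or_congr Iff.rfl (h.verified p sl' k hk)

/-- A probe from `w` that is accepted in one of two similar executions and missing from the other
one keeps them similar. -/
theorem Similar.verify_left {w k : Fin C.n} {sl : Slot C.n} {σ₁ σ₂ τ : State C.n Payload Hash}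
    {x : Hash} (h : Similar w sl σ₁ σ₂) (hk : k ∉ C.faulty) (hp : (w, sl, k) ∈ σ₁.probed)
    (hkh : σ₁.heard (k, sl) = σ₂.heard (k, sl))
    (hr : ActiveT.receive C σ₁ k sl x = (τ, .accepted)) :
    Similar w sl { τ with verified := insert (w, sl, k) τ.verified } σ₂ := by
  have hv (V) (hV : V = σ₁.verified) (p sl' k') (h' : k' ∈ C.faulty ∨ (p, sl') ≠ (w, sl)) :
      (p, sl', k') ∈ insert (w, sl, k) V ↔ (p, sl', k') ∈ σ₂.verified := by
    rw [hV, ← h.verified p sl' k' h', Finset.mem_insert, or_iff_right]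
    rintro ⟨⟩
    tauto
  rcases receive_cases σ₁ k sl x with ⟨_, e⟩ | ⟨_, h', e⟩ | ⟨_, h', e⟩ | ⟨_, h', e⟩ <;>
    rw [e] at hr <;> simp at hr <;> subst hr
  · refine ⟨by rw [h.eq], fun i => ?_, hv _ rfl⟩
    by_cases hi : i = (k, sl)
    · subst hi
      exact .inr ⟨rfl, hp, .inr (hkh ▸ h')⟩
    · simpa [Function.update_of_ne hi] using h.heard i
  · exact ⟨by rw [h.eq], h.heard, hv _ rfl⟩

/-- Two outcomes of the random choices that differ at most in the correct processes that `w`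
selects for `sl`. -/
structure AgreeOff (w : Fin C.n) (sl : Slot C.n) (ω₁ ω₂ : Coins C.n) : Prop where
  eq : ∀ d, d ≠ .target w sl → ω₁ d = ω₂ d
  inter : ω₁ (.target w sl) ∩ C.faulty = ω₂ (.target w sl) ∩ C.faulty
  left : ω₁ (.target w sl) ⊆ C.W3T sl
  right : ω₂ (.target w sl) ⊆ C.W3T sl

theorem AgreeOff.target_inter {w : Fin C.n} {sl : Slot C.n} {ω₁ ω₂ : Coins C.n}
    (h : AgreeOff w sl ω₁ ω₂) (p : Fin C.n) (sl' : Slot C.n) :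
    ω₁ (.target p sl') ∩ C.faulty = ω₂ (.target p sl') ∩ C.faulty := by
  by_cases e : (p, sl') = (w, sl)
  · cases e; exact h.inter
  · rw [h.eq]
    rintro ⟨⟩
    exact e rfl

variable (H : Message C.n Payload → Hash)

/-- The correct targets of `w` for `sl` are read only by `probe`, whose accepted outcome is silent,
and by `avAck`, whose guard waits for all correct members of `W3T sl`. Start of probing reveals only
the faulty targets, on which the outcomes agree. -/
theorem Similar.step {w : Fin C.n} {sl : Slot C.n} {ω₁ ω₂ : Coins C.n}
    (hω : AgreeOff w sl ω₁ ω₂) {σ₁ σ₂ : State C.n Payload Hash} (h : Similar w sl σ₁ σ₂)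
    (I₁ : Invariant C ω₁ σ₁) (I₂ : Invariant C ω₂ σ₂) (a : Action C.n Payload Hash)
    (h₁ : sl.1 ∉ (step C H ω₁ σ₁ a).1.alerted) (h₂ : sl.1 ∉ (step C H ω₂ σ₂ a).1.alerted) :
    Similar w sl (step C H ω₁ σ₁ a).1 (step C H ω₂ σ₂ a).1 ∧
      (step C H ω₁ σ₁ a).2 = (step C H ω₂ σ₂ a).2 := by
  have hsim := h
  obtain ⟨he, hh, hv⟩ := h
  obtain ⟨hd, vf, rfl⟩ : ∃ hd vf, σ₂ = { σ₁ with heard := hd, verified := vf } := ⟨_, _, he⟩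
  have hSg (sl' x) : Signed C { σ₁ with heard := hd, verified := vf } sl' x ↔
    Signed C σ₁ sl' x := Iff.rfl
  have hwit (sl') : ω₂ (.witness sl') = ω₁ (.witness sl') := (hω.eq _ (by simp)).symm
  have hrec (p sl' x) := hsim.receive p sl' x
  have hsame (i) := hsim.heard_eq_of_ne_none (i := i)
  have hal : sl.1 ∉ σ₁.alerted := fun h => h₁ ((step_extends H ω₁ σ₁ a).alerted h)
  clear he
  dsimp only at hh hv hsame
  cases a with
  | idle => exact ⟨⟨rfl, hh, hv⟩, rfl⟩
  | query sl' => simp only [ActiveT.step, hwit]; exact ⟨⟨rfl, hh, hv⟩, trivial⟩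
  | multicast m => simp only [ActiveT.step]; split_ifs <;> exact ⟨⟨rfl, hh, hv⟩, rfl⟩
  | timeout sl' => simp only [ActiveT.step]; split_ifs <;> exact ⟨⟨rfl, hh, hv⟩, rfl⟩
  | avRegular p sl' x =>
    have hrec := hrec p sl' x
    simp only [ActiveT.step, hSg, hwit] at h₁ h₂ ⊢
    split_ifs at h₁ h₂ ⊢ with hc
    · generalize ActiveT.receive C σ₁ p sl' x = r₁ at *
      generalize ActiveT.receive C _ p sl' x = r₂ at *
      obtain ⟨τ₁, ρ₁⟩ := r₁
      obtain ⟨τ₂, ρ₂⟩ := r₂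
      have g₁ : sl.1 ∉ τ₁.alerted := by
        cases ρ₁ with
        | accepted => dsimp only at h₁; split_ifs at h₁ <;> exact h₁
        | _ => exact h₁
      have g₂ : sl.1 ∉ τ₂.alerted := by
        cases ρ₂ with
        | accepted => dsimp only at h₂; split_ifs at h₂ <;> exact h₂
        | _ => exact h₂
      obtain ⟨hτ, hρ⟩ := hrec g₁ g₂
      dsimp only at hτ hρ
      subst hρ
      cases ρ₁ with
      | accepted =>
        have hp : τ₂.probing = τ₁.probing := by rw [hτ.eq]
        simp only [hp]
        split_ifs
        · exact ⟨hτ, rfl⟩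
        · exact ⟨⟨by rw [hτ.eq], hτ.heard, hτ.verified⟩, by rw [hω.target_inter]⟩
      | _ => exact ⟨hτ, rfl⟩
    · exact ⟨hsim, rfl⟩
  | tRegular p sl' x =>
    have hrec := hrec p sl' x
    simp only [ActiveT.step, hSg] at h₁ h₂ ⊢
    split_ifs at h₁ h₂ ⊢ with hc
    · generalize ActiveT.receive C σ₁ p sl' x = r₁ at *
      generalize ActiveT.receive C _ p sl' x = r₂ at *
      obtain ⟨τ₁, ρ₁⟩ := r₁
      obtain ⟨τ₂, ρ₂⟩ := r₂
      have g₁ : sl.1 ∉ τ₁.alerted := by cases ρ₁ <;> exact h₁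
      have g₂ : sl.1 ∉ τ₂.alerted := by cases ρ₂ <;> exact h₂
      obtain ⟨hτ, hρ⟩ := hrec g₁ g₂
      dsimp only at hτ hρ
      subst hρ
      have hp : τ₂.pending = τ₁.pending := by rw [hτ.eq]
      cases ρ₁ with
      | accepted =>
        refine ⟨⟨?_, hτ.heard, hτ.verified⟩, rfl⟩
        dsimp only
        rw [hp]
        rw [hτ.eq]
      | _ => exact ⟨hτ, rfl⟩
    · exact ⟨hsim, rfl⟩
  | inform f p sl' x =>
    have hrec := hrec p sl' x
    simp only [ActiveT.step, hSg] at h₁ h₂ ⊢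
    split_ifs at h₁ h₂ ⊢ with hc
    · generalize ActiveT.receive C σ₁ p sl' x = r₁ at *
      generalize ActiveT.receive C _ p sl' x = r₂ at *
      obtain ⟨τ₁, ρ₁⟩ := r₁
      obtain ⟨τ₂, ρ₂⟩ := r₂
      have g₁ : sl.1 ∉ τ₁.alerted := by cases ρ₁ <;> exact h₁
      have g₂ : sl.1 ∉ τ₂.alerted := by cases ρ₂ <;> exact h₂
      obtain ⟨hτ, hρ⟩ := hrec g₁ g₂
      dsimp only at hτ hρ
      subst hρ
      cases ρ₁ <;> exact ⟨hτ, rfl⟩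
    · exact ⟨hsim, rfl⟩
  | probe p k sl' =>
    have hpe : (p, sl') ∈ σ₁.probing → σ₁.heard (p, sl') = hd (p, sl') := fun hp =>
      hsame _ (I₁.heard_of_probing _ hp) (I₂.heard_of_probing _ hp)
    have hsh₁ := I₁.alerted_of_shun
    have hsh₂ := I₂.alerted_of_shun
    by_cases hc : p ∉ C.faulty ∧ k ∉ C.faulty ∧ (p, sl') ∈ σ₁.probing ∧ (p, sl', k) ∉ σ₁.probed
    swap
    · simp only [ActiveT.step, hc, if_false]
      exact ⟨hsim, trivial⟩
    obtain ⟨x, hx⟩ := Option.ne_none_iff_exists'.1 (I₁.heard_of_probing _ hc.2.2.1)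
    have hx' := (hpe hc.2.2.1).symm.trans hx
    simp only [ActiveT.step, hc, not_false_eq_true, and_self, if_true, hx, hx'] at h₁ h₂ ⊢
    have hsim' : Similar w sl { σ₁ with probed := insert (p, sl', k) σ₁.probed }
        { σ₁ with heard := hd, verified := vf, probed := insert (p, sl', k) σ₁.probed } :=
      ⟨rfl, fun i => (hh i).imp_right (.imp_right (.imp_left Finset.mem_insert_of_mem)), hv⟩
    have hrec' := hsim'.receive k sl' x
    by_cases hp : (p, sl') = (w, sl)
    · obtain ⟨rfl, rfl⟩ := Prod.mk.inj hp
      -- This uses that each pair is probed once: the guard says that `k` has not been probed yet.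
      have hk : σ₁.heard (k, sl') = hd (k, sl') :=
        (hh (k, sl')).resolve_right fun h => hc.2.2.2 h.2.1
      have hv₁ := fun τ => hsim'.verify_left (τ := τ) (x := x) hc.2.1 (Finset.mem_insert_self _ _) hk
      have hv₂ := fun τ => hsim'.symm.verify_left (τ := τ) (x := x) hc.2.1
        (Finset.mem_insert_self _ _) hk.symm
      have hac₁ (τ r) (e : ActiveT.receive C { σ₁ with probed := insert (p, sl', k) σ₁.probed } k sl' x =
          (τ, r)) :=
        alerted_of_receive_ne_accepted
          (σ := { σ₁ with probed := insert (p, sl', k) σ₁.probed }) hsh₁ e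
      have hac₂ (τ r) (e : ActiveT.receive C { σ₁ with
          heard := hd, verified := vf, probed := insert (p, sl', k) σ₁.probed } k sl' x = (τ, r)) :=
        alerted_of_receive_ne_accepted (σ := { σ₁ with
          heard := hd, verified := vf, probed := insert (p, sl', k) σ₁.probed }) hsh₂ e
      -- Wherever `k` is selected, anything but acceptance would expose the sender; acceptance
      -- changes only `heard` and `verified`, as `Similar` permits.
      by_cases t₁ : k ∈ ω₁ (.target p sl') <;> by_cases t₂ : k ∈ ω₂ (.target p sl') <;>
        simp only [t₁, t₂, if_true, if_false] at h₁ h₂ ⊢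
      · generalize ActiveT.receive C _ k sl' x = r₁ at *
        generalize ActiveT.receive C _ k sl' x = r₂ at *
        obtain ⟨τ₁, ρ₁⟩ := r₁
        obtain ⟨τ₂, ρ₂⟩ := r₂
        cases ρ₁ with
        | ignored => exact absurd (hac₁ _ _ rfl (by simp)) h₁
        | conflict => exact absurd (hac₁ _ _ rfl (by simp)) h₁
        | accepted =>
          cases ρ₂ with
          | ignored => exact absurd (hac₂ _ _ rfl (by simp)) h₂
          | conflict => exact absurd (hac₂ _ _ rfl (by simp)) h₂
          | accepted => exact ⟨(hrec' h₁ h₂).1.insert_verified _, rfl⟩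
      · generalize ActiveT.receive C _ k sl' x = r₁ at *
        obtain ⟨τ₁, ρ₁⟩ := r₁
        cases ρ₁ with
        | accepted => exact ⟨hv₁ _ rfl, rfl⟩
        | ignored => exact absurd (hac₁ _ _ rfl (by simp)) h₁
        | conflict => exact absurd (hac₁ _ _ rfl (by simp)) h₁
      · clear hv₁ hac₁ hrec'
        generalize ActiveT.receive C _ k sl' x = r₂ at *
        obtain ⟨τ₂, ρ₂⟩ := r₂
        cases ρ₂ with
        | accepted => exact ⟨(hv₂ _ rfl).symm, rfl⟩
        | ignored => exact absurd (hac₂ _ _ rfl (by simp)) h₂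
        | conflict => exact absurd (hac₂ _ _ rfl (by simp)) h₂
      · exact ⟨hsim', trivial⟩
    · rw [← hω.eq (.target p sl') (by rintro ⟨⟩; exact hp rfl)] at h₂ ⊢
      split_ifs at h₁ h₂ ⊢
      · generalize ActiveT.receive C _ k sl' x = r₁ at *
        generalize ActiveT.receive C _ k sl' x = r₂ at *
        obtain ⟨τ₁, ρ₁⟩ := r₁
        obtain ⟨τ₂, ρ₂⟩ := r₂
        have g₁ : sl.1 ∉ τ₁.alerted := by cases ρ₁ <;> exact h₁
        have g₂ : sl.1 ∉ τ₂.alerted := by cases ρ₂ <;> exact h₂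
        obtain ⟨hτ, hρ⟩ := hrec' g₁ g₂
        dsimp only at hτ hρ
        subst hρ
        cases ρ₁ with
        | accepted => exact ⟨hτ.insert_verified _, rfl⟩
        | _ => exact ⟨hτ, rfl⟩
      · exact ⟨hsim', rfl⟩
  | verify f p sl' =>
    simp only [ActiveT.step]
    split_ifs with hc
    · refine ⟨⟨rfl, hh, fun q sl'' k hk => ?_⟩, rfl⟩
      simp only [Finset.mem_insert]
      exact or_congr Iff.rfl (hv q sl'' k hk)
    · exact ⟨⟨rfl, hh, hv⟩, rfl⟩
  | avAck p sl' =>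
    -- Faulty targets and their replies agree in both executions; correct targets have all verified,
    -- by `verified_of_probed`.
    have hall : (∀ k ∈ C.W3T sl' \ C.faulty, (p, sl', k) ∈ σ₁.probed) →
        ((∀ k ∈ ω₁ (.target p sl'), (p, sl', k) ∈ σ₁.verified) ↔
          ∀ k ∈ ω₂ (.target p sl'), (p, sl', k) ∈ vf) := by
      intro hpr
      by_cases hp : (p, sl') = (w, sl)
      · obtain ⟨rfl, rfl⟩ := Prod.mk.inj hp
        have hf (k) (hk : k ∈ C.faulty) : k ∈ ω₁ (.target p sl') ↔ k ∈ ω₂ (.target p sl') := by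
          have := Finset.ext_iff.1 hω.inter k
          simpa [hk] using this
        have hcorrect (k) (hk : k ∉ C.faulty) (h : k ∈ C.W3T sl') : (p, sl', k) ∈ σ₁.probed :=
          hpr k (Finset.mem_sdiff.2 ⟨h, hk⟩)
        refine ⟨fun h k hk => ?_, fun h k hk => ?_⟩ <;> by_cases hkf : k ∈ C.faulty
        · exact (hv p sl' k (.inl hkf)).1 (h k ((hf k hkf).2 hk))
        · exact I₂.verified_of_probed p sl' k hal (hcorrect k hkf (hω.right hk)) hk
        · exact (hv p sl' k (.inl hkf)).2 (h k ((hf k hkf).1 hk))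
        · exact I₁.verified_of_probed p sl' k hal (hcorrect k hkf (hω.left hk)) hk
      · rw [hω.eq (.target p sl') (by rintro ⟨⟩; exact hp rfl)]
        exact forall₂_congr fun k _ => hv p sl' k (.inr hp)
    have hpe : (p, sl') ∈ σ₁.probing → σ₁.heard (p, sl') = hd (p, sl') := fun hp =>
      hsame _ (I₁.heard_of_probing _ hp) (I₂.heard_of_probing _ hp)
    have hcond : (p ∉ C.faulty ∧ (p, sl') ∈ σ₁.probing ∧ (p, sl'.1) ∉ σ₁.shun ∧
        (∀ k ∈ C.W3T sl' \ C.faulty, (p, sl', k) ∈ σ₁.probed) ∧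
        (∀ k ∈ ω₁ (.target p sl'), (p, sl', k) ∈ σ₁.verified)) ↔
        (p ∉ C.faulty ∧ (p, sl') ∈ σ₁.probing ∧ (p, sl'.1) ∉ σ₁.shun ∧
        (∀ k ∈ C.W3T sl' \ C.faulty, (p, sl', k) ∈ σ₁.probed) ∧
        (∀ k ∈ ω₂ (.target p sl'), (p, sl', k) ∈ vf)) :=
      and_congr_right fun _ => and_congr_right fun _ => and_congr_right fun _ =>
        and_congr_right hall
    simp only [ActiveT.step]
    split_ifs with hc hc' hc'
    · rw [← hpe hc.2.1]
      split <;> exact ⟨⟨rfl, hh, hv⟩, rfl⟩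
    · exact absurd (hcond.1 hc) hc'
    · exact absurd (hcond.2 hc') hc
    · exact ⟨⟨rfl, hh, hv⟩, rfl⟩
  | tAck p sl' =>
    have hpe : (p, sl') ∈ σ₁.pending → σ₁.heard (p, sl') = hd (p, sl') := fun hp =>
      hsame _ (I₁.heard_of_pending _ hp) (I₂.heard_of_pending _ hp)
    simp only [ActiveT.step]
    split_ifs with hc
    · rw [← hpe hc.2.1]
      split <;> exact ⟨⟨rfl, hh, hv⟩, rfl⟩
    · exact ⟨⟨rfl, hh, hv⟩, rfl⟩
  | hear p s => simp only [ActiveT.step]; split_ifs <;> exact ⟨⟨rfl, hh, hv⟩, rfl⟩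
  | deliverAV p m =>
    have hV : ValidAV C { σ₁ with heard := hd, verified := vf } (ω₁ (.witness m.slot)) m.slot (H m) ↔
      ValidAV C σ₁ (ω₁ (.witness m.slot)) m.slot (H m) := Iff.rfl
    simp only [ActiveT.step, hwit, hV]
    split_ifs <;> exact ⟨⟨rfl, hh, hv⟩, rfl⟩
  | deliver3T p m S =>
    have hV : Valid3T C { σ₁ with heard := hd, verified := vf } S m.slot (H m) ↔
      Valid3T C σ₁ S m.slot (H m) := Iff.rfl
    simp only [ActiveT.step, hV]
    split_ifs <;> exact ⟨⟨rfl, hh, hv⟩, rfl⟩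

variable (A : Adversary C Payload Hash)

/-- As long as the sender of `sl` is not exposed, the adversary learns nothing about the correct
processes that `w` selects. -/
theorem similar_run {w : Fin C.n} {sl : Slot C.n} {ω₁ ω₂ : Coins C.n} (hω : AgreeOff w sl ω₁ ω₂)
    (k : ℕ) (h₁ : sl.1 ∉ (run C H A ω₁ k).1.alerted) (h₂ : sl.1 ∉ (run C H A ω₂ k).1.alerted) :
    Similar w sl (run C H A ω₁ k).1 (run C H A ω₂ k).1 ∧
      (run C H A ω₁ k).2 = (run C H A ω₂ k).2 := by
  induction k with
  | zero => exact ⟨.refl w sl _, rfl⟩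
  | succ k ih =>
    obtain ⟨hs, ho⟩ := ih (fun h => h₁ (alerted_run_mono H A ω₁ k.le_succ h))
      (fun h => h₂ (alerted_run_mono H A ω₂ k.le_succ h))
    have := hs.step H hω (invariant_run H A ω₁ k) (invariant_run H A ω₂ k) (A (run C H A ω₁ k).2) h₁
      (by rw [ho]; exact h₂)
    simp only [run]
    rw [← ho]
    exact ⟨this.1, by rw [this.2]⟩

/-- The sender is not exposed when the first recovery set is complete. -/
theorem notMem_alerted_of_valid3T {sl : Slot C.n} {ω : Coins C.n} {k : ℕ} {S : Finset (Fin C.n)}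
    {x : Hash} (hS : Valid3T C (run C H A ω k).1 S sl x)
    (hk : ∀ j < k, ∀ S x, ¬ Valid3T C (run C H A ω j).1 S sl x) :
    sl.1 ∉ (run C H A ω k).1.alerted := by
  intro hal
  cases k with
  | zero =>
    -- Applied to `S` twice, this yields a correct member of `S`, which cannot have acknowledged at
    -- time zero.
    obtain ⟨p, hp, hpf⟩ := hS.1.exists_correct hS.1
    rw [Finset.mem_inter] at hp
    simpa [run, State.init] using (hS.2 p hp.1).resolve_left hpf
  | succ k =>
    -- If the sender were exposed now, the last event added no 3T-acknowledgment for it, so `S` was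
    -- complete one event earlier.
    refine hk k k.lt_succ_self S x ⟨hS.1, fun p hp => (hS.2 p hp).imp_right fun h => ?_⟩
    exact ((step_extends H ω _ _).fresh_tAcks _ _ _ h).resolve_right fun h => h hal

/-- All the conflicting executions that differ only in the correct processes selected by `w` have
the same first recovery set, which `w` has missed. -/
theorem exists_disjoint_target (hA : CollisionFree C H A) {w : Fin C.n} {sl : Slot C.n}
    (hwf : w ∉ C.faulty) (Ω : Set (Coins C.n)) (hΩ : ∀ ω₁ ∈ Ω, ∀ ω₂ ∈ Ω, AgreeOff w sl ω₁ ω₂)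
    (hconf : Ω ⊆ Conflict C H A sl) (hw : ∀ ω ∈ Ω, w ∈ ω (.witness sl)) (hne : Ω.Nonempty) :
    ∃ S, RecoverySet C sl S ∧ ∀ ω ∈ Ω, Disjoint (ω (.target w sl)) (S \ C.faulty) := by
  classical
  -- The minimum is taken over times and outcomes jointly, so that at `k₀` no outcome in `Ω` has an
  -- earlier complete recovery set.
  have hex : ∃ k, ∃ ω ∈ Ω, ∃ S y, Valid3T C (run C H A ω k).1 S sl y := by
    obtain ⟨ω, hω⟩ := hne
    obtain ⟨k, S, x, y, -, -, h⟩ := exists_of_conflict H A hA (hconf hω) (hw ω hω) hwf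
    exact ⟨k, ω, hω, S, y, h⟩
  obtain ⟨ω₀, hω₀, S, y, hS⟩ := Nat.find_spec hex
  have hmin := fun j (hj : j < Nat.find hex) => Nat.find_min hex hj
  generalize Nat.find hex = k₀ at *
  refine ⟨S, hS.1, fun ω hω => ?_⟩
  obtain ⟨k, S', x, z, hxz, hx, hS'⟩ := exists_of_conflict H A hA (hconf hω) (hw ω hω) hwf
  have h₀ : sl.1 ∉ (run C H A ω₀ k₀).1.alerted :=
    notMem_alerted_of_valid3T H A hS fun j hj S x h => hmin j hj ⟨ω₀, hω₀, S, x, h⟩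
  -- The first recovery set under `ω` is complete no earlier than `k₀`; the sender is unexposed
  -- then, hence also at `k₀`.
  have h : sl.1 ∉ (run C H A ω k₀).1.alerted := by
    have hex' : ∃ k, ∃ S y, Valid3T C (run C H A ω k).1 S sl y := ⟨k, S', z, hS'⟩
    obtain ⟨S₁, y₁, h₁⟩ := Nat.find_spec hex'
    have hle : k₀ ≤ Nat.find hex' := by
      by_contra! hlt
      exact hmin _ hlt ⟨ω, hω, S₁, y₁, h₁⟩
    have := notMem_alerted_of_valid3T H A h₁ fun j hj S x h => Nat.find_min hex' hj ⟨S, x, h⟩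
    exact fun h => this (alerted_run_mono H A ω hle h)
  have hsim := (similar_run H A (hΩ _ hω₀ _ hω) k₀ h₀ h).1
  have htm := tAcks_run_mono H A ω
  have hS₀ : Valid3T C (run C H A ω k₀).1 S sl y := by
    refine ⟨hS.1, fun p hp => ?_⟩
    rw [hsim.eq]
    exact hS.2 p hp
  have lift {j} (hj : k₀ ≤ j) : Valid3T C (run C H A ω j).1 S sl y :=
    ⟨hS₀.1, fun p hp => (hS₀.2 p hp).imp_right fun h => htm hj h⟩
  have hle : k ≤ max k k₀ := le_max_left _ _
  have hlast : Valid3T C (run C H A ω (max k k₀)).1 S' sl z :=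
    ⟨hS'.1, fun p hp => (hS'.2 p hp).imp_right fun h => htm hle h⟩
  have I := invariant_run H A ω (max k k₀)
  -- At a common later time quorum intersection identifies the hash of `S'` with that of `S`, so
  -- `S'` can be replaced by the common set `S`.
  have hzy := I.eq_of_valid3T hlast (lift (le_max_right _ _))
  exact I.disjoint_of_valid3T (avAcks_run_mono H A ω hle hx) (lift (le_max_right _ _)) (hzy ▸ hxz)

end Simulation

/-! ### Counting subsets and uniform probabilities. -/

section Counting

/-- Factor by factor, `(a - k) / (N - k) ≤ a / N`; the cross-multiplied form also survives truncated
subtraction. -/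
theorem descFactorial_mul_pow_le {a N : ℕ} (h : a ≤ N) (k : ℕ) :
    a.descFactorial k * N ^ k ≤ a ^ k * N.descFactorial k := by
  induction k with
  | zero => simp
  | succ k ih =>
    have hstep : (a - k) * N ≤ a * (N - k) := by
      rw [Nat.sub_mul, Nat.mul_sub]
      have := Nat.mul_le_mul_left k h
      rw [mul_comm a k]
      omega
    calc a.descFactorial (k + 1) * N ^ (k + 1)
        = ((a - k) * N) * (a.descFactorial k * N ^ k) := by rw [Nat.descFactorial_succ]; ring
      _ ≤ (a * (N - k)) * (a ^ k * N.descFactorial k) := Nat.mul_le_mul hstep ih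
      _ = a ^ (k + 1) * N.descFactorial (k + 1) := by rw [Nat.descFactorial_succ]; ring

theorem choose_mul_pow_le {a N : ℕ} (h : a ≤ N) (k : ℕ) :
    a.choose k * N ^ k ≤ a ^ k * N.choose k := by
  refine Nat.le_of_mul_le_mul_left ?_ k.factorial_pos
  have := descFactorial_mul_pow_le h k
  rw [Nat.descFactorial_eq_factorial_mul_choose, Nat.descFactorial_eq_factorial_mul_choose] at this
  linarith

/-- A family of `δ`-sets, in which the part inside `F` confines the part outside of `F` to
a set of size `t`, is not larger than the family of the `δ`-sets of a set of `|F| + t` elements. -/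
theorem card_le_choose_of_confined {α : Type*} [DecidableEq α] {δ t : ℕ} {F : Finset α}
    {ℬ : Finset (Finset α)} (hcard : ∀ T ∈ ℬ, T.card = δ)
    (hD : ∀ G ⊆ F, ∃ D : Finset α, D.card ≤ t ∧ ∀ T ∈ ℬ, T ∩ F = G → T \ F ⊆ D) :
    ℬ.card ≤ (F.card + t).choose δ := by
  -- A set in the fibre over `G` is determined by its part outside `F`, a subset of `D` with `δ -
  -- |G|` elements. The guard keeps truncated subtraction from counting the empty set when `|G| >
  -- δ`.
  have hfib : ∀ G ∈ F.powerset, (ℬ.filter fun T => T ∩ F = G).card ≤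
      if G.card ≤ δ then t.choose (δ - G.card) else 0 := by
    intro G hG
    obtain ⟨D, hDt, hD⟩ := hD G (Finset.mem_powerset.1 hG)
    have hTG (T) (hT : T ∈ ℬ.filter fun T => T ∩ F = G) : (T \ F).card + G.card = δ := by
      rw [Finset.mem_filter] at hT
      rw [← hcard T hT.1, ← hT.2, Finset.card_sdiff_add_card_inter]
    split_ifs with h
    · calc (ℬ.filter fun T => T ∩ F = G).card
          ≤ (D.powersetCard (δ - G.card)).card := by
            refine Finset.card_le_card_of_injOn (· \ F) (fun T hT => ?_) fun T hT T' hT' e => ?_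
            · have h₁ := hTG T hT
              have hT := Finset.mem_filter.1 hT
              exact Finset.mem_powersetCard.2 ⟨hD T hT.1 hT.2, by dsimp only; omega⟩
            · have hT := (Finset.mem_filter.1 hT).2
              have hT' := (Finset.mem_filter.1 hT').2
              dsimp only at e
              rw [← Finset.sdiff_union_inter T F, ← Finset.sdiff_union_inter T' F, e, hT, hT']
        _ ≤ t.choose (δ - G.card) := by
            rw [Finset.card_powersetCard]
            exact Nat.choose_le_choose _ hDt
    · refine le_of_eq (Finset.card_eq_zero.2 (Finset.eq_empty_of_forall_notMem fun T hT => ?_))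
      have := hTG T hT
      omega
  calc ℬ.card = ∑ G ∈ F.powerset, (ℬ.filter fun T => T ∩ F = G).card :=
        Finset.card_eq_sum_card_fiberwise fun T _ => by simp
    _ ≤ ∑ G ∈ F.powerset, if G.card ≤ δ then t.choose (δ - G.card) else 0 :=
        Finset.sum_le_sum hfib
    _ = ∑ m ∈ Finset.range (F.card + 1),
          F.card.choose m • if m ≤ δ then t.choose (δ - m) else 0 :=
        Finset.sum_powerset_apply_card fun m => if m ≤ δ then t.choose (δ - m) else 0
    _ = ∑ m ∈ Finset.range (F.card + 1) with m ≤ δ, F.card.choose m * t.choose (δ - m) := by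
        rw [Finset.sum_filter]
        simp
    _ ≤ ∑ m ∈ Finset.range (δ + 1), F.card.choose m * t.choose (δ - m) := by
        refine Finset.sum_le_sum_of_subset fun m hm => ?_
        rw [Finset.mem_filter] at hm
        exact Finset.mem_range.2 (by omega)
    -- Vandermonde's identity.
    _ = (F.card + t).choose δ := by
        rw [Nat.add_choose_eq, Finset.Nat.sum_antidiagonal_eq_sum_range_succ
          (fun i j => F.card.choose i * t.choose j)]

theorem uniformOn_finset_apply {α : Type*} [MeasurableSpace α] [MeasurableSingletonClass α]
    (s : Finset α) (X : Set α) [DecidablePred (· ∈ X)] :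
    uniformOn (s : Set α) X = (s.filter (· ∈ X)).card / s.card := by
  classical
  have : (s : Set α) ∩ X = (s : Set α) ∩ (s.filter (· ∈ X) : Finset α) := by
    ext x
    simp +contextual
  rw [← uniformOn_inter_self s.finite_toSet, this, uniformOn_inter_self s.finite_toSet,
    uniformOn_apply_finset, Finset.inter_eq_right.2 (Finset.filter_subset _ _)]

/-- The probability of an event for a uniformly random `k`-subset of `V`. -/
theorem uniformOn_powersetCard_le {α : Type*} [MeasurableSpace (Finset α)]
    [MeasurableSingletonClass (Finset α)] {V : Finset α} {a k : ℕ} (hk : k ≤ V.card)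
    (ha : a ≤ V.card) (X : Set (Finset α)) [DecidablePred (· ∈ X)]
    (hX : ((V.powersetCard k).filter (· ∈ X)).card ≤ a.choose k) :
    uniformOn (V.powersetCard k : Set (Finset α)) X ≤ ENNReal.ofReal ((a / V.card : ℝ) ^ k) := by
  rw [uniformOn_finset_apply, Finset.card_powersetCard]
  have hpos : 0 < V.card.choose k := Nat.choose_pos hk
  rw [ENNReal.div_le_iff (by exact_mod_cast hpos.ne') (ENNReal.natCast_ne_top _),
    ← ENNReal.ofReal_natCast, ← ENNReal.ofReal_natCast (V.card.choose k),
    ← ENNReal.ofReal_mul (by positivity)]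
  refine ENNReal.ofReal_le_ofReal ((Nat.cast_le.2 hX).trans ?_)
  -- Only for `k = 0` can `V` be empty, which would make the division meaningless.
  rcases Nat.eq_zero_or_pos k with rfl | hk0
  · simp
  have hV : (0 : ℝ) < V.card := by exact_mod_cast hk0.trans_le hk
  rw [div_pow, div_mul_eq_mul_div, le_div_iff₀ (by positivity)]
  exact_mod_cast choose_mul_pow_le ha k

end Counting

/-! ### Redrawing one coordinate of a product measure. -/

section Resampling

theorem measurable_update_prod {ι : Type*} [DecidableEq ι] {X : ι → Type*}
    [∀ i, MeasurableSpace (X i)] (d : ι) :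
    Measurable fun p : (∀ i, X i) × X d => Function.update p.1 d p.2 := by
  refine measurable_pi_lambda _ fun i => ?_
  by_cases h : i = d
  · subst h; simpa using measurable_snd
  · simp only [Function.update_of_ne h]
    exact (measurable_pi_apply i).comp measurable_fst

/-- Redrawing one coordinate does not change the law of a family of independent draws. -/
theorem map_update_infinitePi {ι : Type*} [DecidableEq ι] {X : ι → Type*}
    [∀ i, MeasurableSpace (X i)] (μ : ∀ i, Measure (X i)) [∀ i, IsProbabilityMeasure (μ i)]
    (d : ι) :
    ((Measure.infinitePi μ).prod (μ d)).map (fun p => Function.update p.1 d p.2) =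
      Measure.infinitePi μ := by
  refine Measure.eq_infinitePi μ fun s t ht => ?_
  have hm := measurable_update_prod (X := X) d
  rw [Measure.map_apply hm (.pi s.countable_toSet fun i _ => ht i)]
  by_cases hd : d ∈ s
  · have : (fun p : (∀ i, X i) × X d => Function.update p.1 d p.2) ⁻¹' (s : Set ι).pi t =
        ((s.erase d : Finset ι) : Set ι).pi t ×ˢ t d := by
      ext p
      simp only [Set.mem_preimage, Set.mem_pi, Set.mem_prod, Finset.mem_coe, Finset.mem_erase]
      refine ⟨fun h => ⟨fun i hi => ?_, ?_⟩, fun h i hi => ?_⟩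
      · simpa [Function.update_of_ne hi.1] using h i hi.2
      · simpa using h d hd
      · by_cases e : i = d
        · subst e; simpa using h.2
        · simpa [Function.update_of_ne e] using h.1 i ⟨e, hi⟩
    rw [this, Measure.prod_prod, Measure.infinitePi_pi μ fun i _ => ht i,
      Finset.prod_erase_mul _ _ hd]
  · have : (fun p : (∀ i, X i) × X d => Function.update p.1 d p.2) ⁻¹' (s : Set ι).pi t =
        (s : Set ι).pi t ×ˢ Set.univ := by
      ext p
      simp only [Set.mem_preimage, Set.mem_pi, Set.mem_prod, Finset.mem_coe, Set.mem_univ, and_true]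
      refine forall₂_congr fun i hi => ?_
      rw [Function.update_of_ne (ne_of_mem_of_not_mem hi hd)]
    rw [this, Measure.prod_prod, Measure.infinitePi_pi μ fun i _ => ht i, measure_univ, mul_one]

/-- If redrawing coordinate `d` leads to `E` with probability at most `q` on the event `B`, and
never outside of `B`, then `E` has at most `q` times the probability of `B`. -/
theorem infinitePi_le_mul_of_update {ι : Type*} [DecidableEq ι] {X : ι → Type*}
    [∀ i, MeasurableSpace (X i)] (μ : ∀ i, Measure (X i)) [∀ i, IsProbabilityMeasure (μ i)]
    (d : ι) {E B : Set (∀ i, X i)} (hE : MeasurableSet E) (hB : MeasurableSet B) (q : ENNReal)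
    (h : ∀ ω ∈ B, μ d {T | Function.update ω d T ∈ E} ≤ q)
    (h' : ∀ ω ∉ B, ∀ T, Function.update ω d T ∉ E) :
    Measure.infinitePi μ E ≤ q * Measure.infinitePi μ B := by
  have hm := measurable_update_prod (X := X) d
  -- With the redrawn coordinate as a separate factor, Tonelli reduces the claim to a bound for each
  -- fixed `ω`.
  conv_lhs => rw [← map_update_infinitePi μ d]
  rw [Measure.map_apply hm hE, Measure.prod_apply (hm hE)]
  calc ∫⁻ ω, μ d (Prod.mk ω ⁻¹' ((fun p : (∀ i, X i) × X d => Function.update p.1 d p.2) ⁻¹' E))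
        ∂Measure.infinitePi μ
      ≤ ∫⁻ ω, B.indicator (fun _ => q) ω ∂Measure.infinitePi μ := by
        refine lintegral_mono fun ω => ?_
        by_cases hω : ω ∈ B
        · rw [Set.indicator_of_mem hω]
          exact h ω hω
        · rw [Set.indicator_of_notMem hω]
          refine le_of_eq ?_
          convert measure_empty (μ := μ d)
          exact Set.eq_empty_of_forall_notMem fun T hT => h' ω hω T hT
    _ = q * Measure.infinitePi μ B := lintegral_indicator_const hB q

end Resampling

/-! ### Measurability of events of an execution, and the law of a single draw. -/

section Measurability

variable {C : Config} {Payload Hash : Type*} [DecidableEq Hash]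
  (H : Message C.n Payload → Hash)

/-- Every event of an execution depends on at most two draws. -/
theorem exists_step_congr (a : Action C.n Payload Hash) : ∃ d₁ d₂ : Draw C.n, ∀ ω ω' : Coins C.n,
    ω d₁ = ω' d₁ → ω d₂ = ω' d₂ → ∀ σ : State C.n Payload Hash,
      step C H ω σ a = step C H ω' σ a := by
  -- A dummy slot for the events that read no draw.
  have s₀ : Slot C.n := (⟨0, by have := C.three_t_lt; omega⟩, 0)
  cases a with
  | query sl => exact ⟨.witness sl, .witness sl, fun ω ω' h _ σ => by simp only [step, h]⟩
  | avRegular p sl x =>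
    exact ⟨.witness sl, .target p sl, fun ω ω' h h' σ => by simp only [step, h, h']⟩
  | probe p k sl =>
    exact ⟨.target p sl, .target p sl, fun ω ω' h _ σ => by simp only [step, h]⟩
  | avAck p sl => exact ⟨.target p sl, .target p sl, fun ω ω' h _ σ => by simp only [step, h]⟩
  | deliverAV p m =>
    exact ⟨.witness m.slot, .witness m.slot, fun ω ω' h _ σ => by simp only [step, h]⟩
  | _ => exact ⟨.witness s₀, .witness s₀, fun ω ω' _ _ σ => by simp only [step]⟩

instance countable_draw (n : ℕ) : Countable (Draw n) := by
  let f : Draw n → Slot n ⊕ Fin n × Slot n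
    | .witness sl => .inl sl
    | .target p sl => .inr (p, sl)
  refine Function.Injective.countable (f := f) ?_
  rintro (_ | _) (_ | _) h <;> simp_all [f]

/-- The first `k` events read finitely many draws, so the run is locally constant in `ω` for the
product of discrete topologies, and any set of results has an open preimage. Thus payloads, hashes
and adversary need no measurable structure; countability of `Draw` makes open sets measurable. -/
theorem measurableSet_run (A : Adversary C Payload Hash) (k : ℕ)
    (P : Set (State C.n Payload Hash × List (Obs C.n))) :
    MeasurableSet {ω | run C H A ω k ∈ P} := by
  let : TopologicalSpace (Finset (Fin C.n)) := ⊥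
  have : DiscreteTopology (Finset (Fin C.n)) := ⟨rfl⟩
  have hloc (ω : Coins C.n) (d) : ∀ᶠ ω' in nhds ω, ω d = ω' d := by
    filter_upwards [(continuous_apply d).continuousAt.eventually
      (mem_nhds_discrete.2 (Set.mem_singleton (ω d)))] with ω' h using h.symm
  have hrun (ω : Coins C.n) (k) : ∀ᶠ ω' in nhds ω, run C H A ω k = run C H A ω' k := by
    induction k with
    | zero => simp [run]
    | succ k ih =>
      obtain ⟨d₁, d₂, h⟩ := exists_step_congr H (A (run C H A ω k).2)
      filter_upwards [ih, hloc ω d₁, hloc ω d₂] with ω' e h₁ h₂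
      simp only [run]
      rw [← e, h ω ω' h₁ h₂]
  refine IsOpen.measurableSet (isOpen_iff_mem_nhds.2 fun ω hω => ?_)
  filter_upwards [hrun ω k] with ω' e
  exact e ▸ hω

theorem measurableSet_conflict (A : Adversary C Payload Hash) (sl : Slot C.n) :
    MeasurableSet (Conflict C H A sl) := by
  have : Conflict C H A sl = ⋃ k, {ω | run C H A ω k ∈
      {r | ∃ (p p' : Fin C.n) (m m' : Message C.n Payload),
        p ∉ C.faulty ∧ p' ∉ C.faulty ∧ m.slot = sl ∧ m'.slot = sl ∧
        (p, m) ∈ r.1.delivered ∧ (p', m') ∈ r.1.delivered ∧ m ≠ m'}} := by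
    ext ω
    simp [Conflict]
  rw [this]
  exact .iUnion fun k => measurableSet_run H A k _

theorem measurableSet_draw {n : ℕ} (d : Draw n) (X : Set (Finset (Fin n))) :
    MeasurableSet {ω : Coins n | ω d ∈ X} :=
  measurable_pi_apply d X.toFinite.measurableSet

theorem law_draw (C : Config) (d : Draw C.n) (X : Set (Finset (Fin C.n))) :
    C.law {ω | ω d ∈ X} = uniformOn (C.choices d : Set (Finset (Fin C.n))) X := by
  have hX : MeasurableSet X := X.toFinite.measurableSet
  conv_rhs => rw [← Measure.infinitePi_map_eval
    (fun d => uniformOn (C.choices d : Set (Finset (Fin C.n)))) d]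
  rw [Measure.map_apply (measurable_pi_apply d) hX]
  rfl

end Measurability

/-! ### Probability bounds for the protocol. -/

section Bounds

theorem RecoverySet.card_W3T_sdiff_le {C : Config} {sl : Slot C.n} {S : Finset (Fin C.n)}
    (hS : RecoverySet C sl S) :
    (C.W3T sl \ (S \ C.faulty)).card ≤ 2 * C.t := by
  have h₁ := hS.card_sdiff
  have h₂ := Finset.card_le_card (Finset.inter_subset_left : C.faulty ∩ C.W3T sl ⊆ C.faulty)
  have h₃ := C.card_faulty
  rw [Finset.card_sdiff_of_subset (Finset.sdiff_subset.trans hS.1), C.card_W3T]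
  omega

theorem law_witnessesFaulty_le (C : Config) (sl : Slot C.n) :
    C.law {ω | ω (.witness sl) ⊆ C.faulty} ≤ ENNReal.ofReal (((C.t : ℝ) / C.n) ^ C.κ) := by
  classical
  have ht : C.t ≤ C.n := by have := C.three_t_lt; omega
  have h := law_draw C (.witness sl) {W | W ⊆ C.faulty}
  refine (le_of_eq h).trans ?_
  refine (uniformOn_powersetCard_le (a := C.t) (by simpa using C.κ_le) (by simpa using ht) _
    ?_).trans (by simp)
  calc _ ≤ (C.faulty.powersetCard C.κ).card := by
        refine Finset.card_le_card fun W hW => ?_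
        rw [Finset.mem_filter, Finset.mem_powersetCard] at hW
        exact Finset.mem_powersetCard.2 ⟨hW.2, hW.1.2⟩
    _ ≤ C.t.choose C.κ := by
        rw [Finset.card_powersetCard]
        exact Nat.choose_le_choose _ C.card_faulty

/-- A bound on the number of target sets in `X` gives a bound on the probability of `X`. -/
theorem uniformOn_choices_target_le (C : Config) (p : Fin C.n) (sl : Slot C.n)
    (X : Set (Finset (Fin C.n))) [DecidablePred (· ∈ X)]
    (hX : (((C.W3T sl).powersetCard C.δ).filter (· ∈ X)).card ≤ (2 * C.t).choose C.δ) :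
    uniformOn (C.choices (.target p sl) : Set (Finset (Fin C.n))) X ≤
      ENNReal.ofReal (((2 * C.t : ℝ) / (3 * C.t + 1)) ^ C.δ) := by
  refine (uniformOn_powersetCard_le (a := 2 * C.t) (by rw [C.card_W3T]; exact C.δ_le)
    (by rw [C.card_W3T]; omega) X hX).trans (by rw [C.card_W3T]; push_cast; rfl)

/-- At most `2t` members of `W3T sl` remain outside the correct part of `S`. As `S` is fixed in
advance, this does not bound conflicts, where `S` is chosen adaptively. -/
theorem law_disjoint_target_le (C : Config) (p : Fin C.n) {sl : Slot C.n} {S : Finset (Fin C.n)}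
    (hS : RecoverySet C sl S) :
    C.law {ω | Disjoint (ω (.target p sl)) (S \ C.faulty)} ≤
      ENNReal.ofReal (((2 * C.t : ℝ) / (3 * C.t + 1)) ^ C.δ) := by
  classical
  refine (le_of_eq (law_draw C (.target p sl) {T | Disjoint T (S \ C.faulty)})).trans ?_
  refine uniformOn_choices_target_le C p sl _ ?_
  calc _ ≤ ((C.W3T sl \ (S \ C.faulty)).powersetCard C.δ).card := by
        refine Finset.card_le_card fun T hT => ?_
        rw [Finset.mem_filter, Finset.mem_powersetCard] at hT
        exact Finset.mem_powersetCard.2 ⟨Finset.subset_sdiff.2 ⟨hT.1.1, hT.2⟩, hT.1.2⟩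
    _ ≤ (2 * C.t).choose C.δ := by
        rw [Finset.card_powersetCard]
        exact Nat.choose_le_choose _ hS.card_W3T_sdiff_le

variable {C : Config} {Payload Hash : Type*} [DecidableEq Hash]
  (H : Message C.n Payload → Hash) (A : Adversary C Payload Hash)

/-- Whatever the other draws are, redrawing the targets of a correct witness leads to conflicting
deliveries with small probability. -/
theorem uniformOn_update_conflict_le [DecidableEq (Draw C.n)] (hA : CollisionFree C H A)
    {w : Fin C.n} {sl : Slot C.n} (hwf : w ∉ C.faulty) {ω : Coins C.n} (hw : w ∈ ω (.witness sl)) :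
    uniformOn (C.choices (.target w sl) : Set (Finset (Fin C.n)))
        {T | Function.update ω (.target w sl) T ∈ Conflict C H A sl} ≤
      ENNReal.ofReal (((2 * C.t : ℝ) / (3 * C.t + 1)) ^ C.δ) := by
  classical
  refine uniformOn_choices_target_le C w sl _ ?_
  set ℬ := ((C.W3T sl).powersetCard C.δ).filter
    (· ∈ {T | Function.update ω (.target w sl) T ∈ Conflict C H A sl}) with hℬ
  have hmem (T) (hT : T ∈ ℬ) : (T ⊆ C.W3T sl ∧ T.card = C.δ) ∧
      Function.update ω (.target w sl) T ∈ Conflict C H A sl := by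
    rw [hℬ, Finset.mem_filter, Finset.mem_powersetCard] at hT
    exact hT
  have hb : (C.faulty ∩ C.W3T sl).card ≤ C.t :=
    (Finset.card_le_card Finset.inter_subset_left).trans C.card_faulty
  refine (card_le_choose_of_confined (F := C.faulty ∩ C.W3T sl) (t := C.t)
    (fun T hT => (hmem T hT).1.2) fun G hG => ?_).trans (Nat.choose_le_choose _ (by omega))
  by_cases hne : ∃ T ∈ ℬ, T ∩ (C.faulty ∩ C.W3T sl) = G
  swap
  -- No bad target set has faulty part `G`, so any confining set will do.
  · exact ⟨∅, by simp, fun T hT e => absurd ⟨T, hT, e⟩ hne⟩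
  obtain ⟨T₀, hT₀, e₀⟩ := hne
  have hin (T) (hT : T ∈ ℬ) : T ∩ (C.faulty ∩ C.W3T sl) = T ∩ C.faulty := by
    rw [Finset.inter_comm C.faulty, ← Finset.inter_assoc,
      Finset.inter_eq_left.2 (hmem T hT).1.1]
  obtain ⟨S, hS, hdis⟩ := exists_disjoint_target H A hA (sl := sl) hwf
    {ω' | ∃ T ∈ ℬ, T ∩ (C.faulty ∩ C.W3T sl) = G ∧ Function.update ω (.target w sl) T = ω'}
    (by
      rintro _ ⟨T, hT, e, rfl⟩ _ ⟨T', hT', e', rfl⟩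
      refine ⟨fun d hd => by simp [Function.update_of_ne hd], ?_, ?_, ?_⟩
      · rw [Function.update_self, Function.update_self, ← hin T hT, ← hin T' hT', e, e']
      · simpa using (hmem T hT).1.1
      · simpa using (hmem T' hT').1.1)
    (by rintro _ ⟨T, hT, -, rfl⟩; exact (hmem T hT).2)
    (by rintro _ ⟨T, hT, -, rfl⟩; simpa using hw)
    ⟨_, T₀, hT₀, e₀, rfl⟩
  -- With `f = |C.faulty ∩ C.W3T sl|`, there are `3t + 1 - f` correct potential witnesses, of which
  -- at least `2t + 1 - f` lie in `S`; at most `t` remain.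
  refine ⟨(C.W3T sl \ (C.faulty ∩ C.W3T sl)) \ (S \ C.faulty), ?_, fun T hT e => ?_⟩
  · have h₁ := hS.card_sdiff
    have hsub : S \ C.faulty ⊆ C.W3T sl \ (C.faulty ∩ C.W3T sl) := by
      intro k hk
      have := @hS.1 k
      simp only [Finset.mem_sdiff, Finset.mem_inter] at hk ⊢
      tauto
    rw [Finset.card_sdiff_of_subset hsub, Finset.card_sdiff_of_subset Finset.inter_subset_right,
      C.card_W3T]
    omega
  · have hd := hdis _ ⟨T, hT, e, rfl⟩
    rw [Function.update_self] at hd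
    exact Finset.subset_sdiff.2
      ⟨Finset.sdiff_subset_sdiff (hmem T hT).1.1 subset_rfl, hd.mono_left Finset.sdiff_subset⟩

/-- The correct witness to be redrawn depends on the active witness set, so that set is fixed to a
value `W` first; redrawing targets does not change it. -/
theorem law_conflict_inter_witness_le (hA : CollisionFree C H A) {sl : Slot C.n}
    {W : Finset (Fin C.n)} (hW : ¬ W ⊆ C.faulty) :
    C.law (Conflict C H A sl ∩ {ω | ω (.witness sl) = W}) ≤
      ENNReal.ofReal (((2 * C.t : ℝ) / (3 * C.t + 1)) ^ C.δ) * C.law {ω | ω (.witness sl) = W} := by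
  classical
  obtain ⟨w, hw, hwf⟩ := Finset.not_subset.1 hW
  have hB : MeasurableSet {ω : Coins C.n | ω (.witness sl) = W} :=
    measurableSet_draw (.witness sl) {W}
  refine infinitePi_le_mul_of_update _ (.target w sl)
    ((measurableSet_conflict H A sl).inter hB) hB _ (fun ω hω => ?_) fun ω hω T h => ?_
  · refine (measure_mono fun T hT => ?_).trans
      (uniformOn_update_conflict_le H A hA hwf (ω := ω) (sl := sl) ?_)
    · exact hT.1
    · have hω : ω (.witness sl) = W := hω
      rwa [hω]
  · have h : Function.update ω (.target w sl) T (.witness sl) = W := h.2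
    rw [Function.update_of_ne (by simp)] at h
    exact hω h

theorem law_conflict_inter_le (hA : CollisionFree C H A) (sl : Slot C.n) :
    C.law ((WitnessesFaulty C sl)ᶜ ∩ Conflict C H A sl) ≤
      ENNReal.ofReal (((2 * C.t : ℝ) / (3 * C.t + 1)) ^ C.δ) * C.law (WitnessesFaulty C sl)ᶜ := by
  classical
  set 𝒲 : Finset (Finset (Fin C.n)) := Finset.univ.filter fun W => ¬ W ⊆ C.faulty
  have hm (W) : MeasurableSet {ω : Coins C.n | ω (.witness sl) = W} :=
    measurableSet_draw (.witness sl) {W}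
  have hF : (WitnessesFaulty C sl)ᶜ = ⋃ W ∈ 𝒲, {ω : Coins C.n | ω (.witness sl) = W} := by
    ext ω
    simp [𝒲, WitnessesFaulty]
  calc C.law ((WitnessesFaulty C sl)ᶜ ∩ Conflict C H A sl)
      ≤ C.law (⋃ W ∈ 𝒲, Conflict C H A sl ∩ {ω : Coins C.n | ω (.witness sl) = W}) := by
        rw [hF, Set.inter_comm, Set.inter_iUnion₂]
    _ ≤ ∑ W ∈ 𝒲, C.law (Conflict C H A sl ∩ {ω : Coins C.n | ω (.witness sl) = W}) :=
        measure_biUnion_finset_le _ _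
    _ ≤ ∑ W ∈ 𝒲, ENNReal.ofReal (((2 * C.t : ℝ) / (3 * C.t + 1)) ^ C.δ) *
          C.law {ω | ω (.witness sl) = W} :=
        Finset.sum_le_sum fun W hW =>
          law_conflict_inter_witness_le H A hA (Finset.mem_filter.1 hW).2
    _ = _ := by
        rw [← Finset.mul_sum, hF, measure_biUnion_finset (fun W _ W' _ h => ?_) fun W _ => hm W]
        exact Set.disjoint_left.2 fun ω h₁ h₂ => h (Eq.trans (Eq.symm h₁) h₂)

end Bounds

end ActiveT

theorem mainTheorem1 (C : Config) {Payload Hash : Type*} [DecidableEq Hash]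
    (H : Message C.n Payload → Hash) (A : Adversary C Payload Hash)
    (hA : CollisionFree C H A) (sl : Slot C.n) :
    -- a completely faulty active witness set
    (C.law.real (WitnessesFaulty C sl) ≤ ((C.t : ℝ) / C.n) ^ C.κ ∧
      ((C.t : ℝ) / C.n) ^ C.κ ≤ (1 / 3 : ℝ) ^ C.κ) ∧
    -- two recovery sets meet at a correct process
    (∀ S S' : Finset (Fin C.n), RecoverySet C sl S → RecoverySet C sl S' →
      ∃ p ∈ S ∩ S', p ∉ C.faulty) ∧
    -- the probes of a witness miss the correct members of a recovery set
    (∀ (h : Fin C.n) (S : Finset (Fin C.n)), RecoverySet C sl S →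
      C.law.real {ω | Disjoint (ω (.target h sl)) (S \ C.faulty)} ≤
        ((2 * C.t : ℝ) / (3 * C.t + 1)) ^ C.δ) ∧
    -- conflicting deliveries, given that the active witness set has a correct member
    ((ProbabilityTheory.cond C.law (WitnessesFaulty C sl)ᶜ).real (Conflict C H A sl) ≤
        ((2 * C.t : ℝ) / (3 * C.t + 1)) ^ C.δ ∧
      ((2 * C.t : ℝ) / (3 * C.t + 1)) ^ C.δ ≤ (2 / 3 : ℝ) ^ C.δ) ∧
    -- conflicting deliveries, overall
    C.law.real (Conflict C H A sl) ≤
      (1 / 3 : ℝ) ^ C.κ + (1 - (1 / 3 : ℝ) ^ C.κ) * (2 / 3 : ℝ) ^ C.δ := by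
  have hFm : MeasurableSet (WitnessesFaulty C sl) :=
    measurableSet_draw (.witness sl) {W | W ⊆ C.faulty}
  have hq0 : (0 : ℝ) ≤ ((2 * C.t : ℝ) / (3 * C.t + 1)) ^ C.δ := by positivity
  have hF : C.law.real (WitnessesFaulty C sl) ≤ ((C.t : ℝ) / C.n) ^ C.κ :=
    ENNReal.toReal_le_of_le_ofReal (by positivity) (law_witnessesFaulty_le C sl)
  have hn : (3 * C.t + 1 : ℝ) ≤ C.n := by exact_mod_cast C.three_t_lt
  have ht0 : (0 : ℝ) ≤ C.t := C.t.cast_nonneg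
  have hκ : ((C.t : ℝ) / C.n) ^ C.κ ≤ (1 / 3 : ℝ) ^ C.κ := by
    refine pow_le_pow_left₀ (by positivity) ?_ _
    rw [div_le_div_iff₀ (by linarith) (by norm_num)]
    linarith
  have hδ : ((2 * C.t : ℝ) / (3 * C.t + 1)) ^ C.δ ≤ (2 / 3 : ℝ) ^ C.δ := by
    refine pow_le_pow_left₀ (by positivity) ?_ _
    rw [div_le_div_iff₀ (by linarith) (by norm_num)]
    linarith
  have hinter := law_conflict_inter_le H A hA sl
  refine ⟨⟨hF, hκ⟩, fun S S' hS hS' => hS.exists_correct hS', fun h S hS =>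
    ENNReal.toReal_le_of_le_ofReal hq0 (law_disjoint_target_le C h hS), ⟨?_, hδ⟩, ?_⟩
  · refine ENNReal.toReal_le_of_le_ofReal hq0 ?_
    rw [cond_apply hFm.compl, mul_comm]
    -- This covers a conditioning event of probability zero as well.
    exact (ENNReal.div_le_of_le_mul hinter)
  · set p := C.law.real (WitnessesFaulty C sl)
    set q := ((2 * C.t : ℝ) / (3 * C.t + 1)) ^ C.δ
    have hc : C.law.real (WitnessesFaulty C sl)ᶜ = 1 - p := probReal_compl_eq_one_sub hFm
    have hi : C.law.real ((WitnessesFaulty C sl)ᶜ ∩ Conflict C H A sl) ≤ q * (1 - p) := by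
      rw [← hc, Measure.real, Measure.real, ← ENNReal.toReal_ofReal hq0, ← ENNReal.toReal_mul]
      exact ENNReal.toReal_mono (ENNReal.mul_ne_top ENNReal.ofReal_ne_top (measure_ne_top _ _))
        hinter
    have hp1 : p ≤ 1 := measureReal_le_one
    have hsub : C.law.real (Conflict C H A sl) ≤
        p + C.law.real ((WitnessesFaulty C sl)ᶜ ∩ Conflict C H A sl) := by
      refine (measureReal_mono fun ω hω => ?_).trans (measureReal_union_le _ _)
      by_cases h : ω ∈ WitnessesFaulty C sl
      exacts [.inl h, .inr ⟨h, hω⟩]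
    have hr : (2 / 3 : ℝ) ^ C.δ ≤ 1 := pow_le_one₀ (by norm_num) (by norm_num)
    calc C.law.real (Conflict C H A sl) ≤ p + q * (1 - p) := hsub.trans (by gcongr)
      _ ≤ p + (2 / 3 : ℝ) ^ C.δ * (1 - p) := by gcongr
      -- With `r = (2/3) ^ δ ≤ 1`, the expression `p + r (1 - p) = r + p (1 - r)` is nondecreasing
      -- in `p`, and `p ≤ (1/3) ^ κ`.
      _ ≤ _ := by nlinarith [mul_nonneg (sub_nonneg.2 (hF.trans hκ)) (sub_nonneg.2 hr)]
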